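/- Let $s>0$ and $C>0$. For $\theta\in\mathbb R^{\mathbb N}$ let $\mu_\theta=\bigotimes_{j\ge1}\mathcal N(\theta_j,1)$, let $\mathcal E(s,C)=\{\theta:\sum_{j\ge1}j^{2s}\theta_j^2\le C\}$ and $\mathcal P_{\mathsf G}=\mathcal P_{\mathsf G}(s,C)=\{\mu_\theta:\theta\in\mathcal E(s,C)\}$. Let $\mathsf{TV}(P,Q)=\sup_A|P(A)-Q(A)|$. Let $n_{\mathsf{TS}}(\epsilon,\delta,\mathcal P_{\mathsf G})$ be the smallest integer $N$ such that for every $n\ge N$ there is a test $\psi$ with values in $\{0,1\}$ which, given independent i.i.d. samples of size $n$ from each of two unknown members $P,Q$ of $\mathcal P_{\mathsf G}$, decides between $H_0:P=Q$ and $H_1:\mathsf{TV}(P,Q)\ge\epsilon$ with worst-case probability of error at most $\delta$ under either hypothesis. Given samples $X=(X_1,\dots,X_n)$ and $Y=(Y_1,\dots,Y_n)$ of points of $\mathbb R^{\mathbb N}$, with empirical mean vectors $\hat\theta^X,\hat\theta^Y$, and $J\in\mathbb N$, put $$\hat S=\{Z\in\mathbb R^{\mathbb N}:T(Z)\ge0\},\qquad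 T(Z)=2\sum_{j=1}^J(\hat\theta^X_j-\hat\theta^Y_j)\Big(Z_j-\tfrac{\hat\theta^X_j+\hat\theta^Y_j}{2}\Big).$$ **Proposition.** There exist constants $c,c'>0$, depending only on $s$ and $C$, such that the following holds for all $\epsilon>0$, all $\delta\in(0,1/2)$, all $\theta^X,\theta^Y\in\mathcal E(s,C)$ with $\mathsf{TV}(\mu_{\theta^X},\mu_{\theta^Y})\ge\epsilon$, and all $n\ge\frac1{c'}\,n_{\mathsf{TS}}(\epsilon,\delta,\mathcal P_{\mathsf G})$. If $X$ and $Y$ are independent i.i.d. samples of size $n$ from $\mu_{\theta^X}$ and $\mu_{\theta^Y}$ respectively, and $J=\lfloor c\,\epsilon^{-1/s}\rfloor$, then $$\mathbb P\Big(\mu_{\theta^X}(\hat S)-\mu_{\theta^Y}(\hat S)\ \ge\ c'\Big(\sqrt{n\epsilon^{1/s}}\wedge\frac1\epsilon\Big)\epsilon^2\Big)\ \ge\ 1-\delta,$$ where the probability is over the samples $X,Y$. -/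

import Mathlib

open MeasureTheory ProbabilityTheory
open scoped ENNReal

noncomputable section

/-- Total variation distance `sup_A |P(A) - Q(A)|` over measurable sets `A`. -/
def tvDist {𝒳 : Type*} [MeasurableSpace 𝒳] (P Q : ProbabilityMeasure 𝒳) : ℝ :=
  ⨆ A : {A : Set 𝒳 // MeasurableSet A},
    |(P : Measure 𝒳).real A.1 - (Q : Measure 𝒳).real A.1|

/-- The joint law of two independent samples, `n` i.i.d. draws from `P` and `n` i.i.d. draws
from `Q`. -/
def twoSampleLaw {𝒳 : Type*} [MeasurableSpace 𝒳] (n : ℕ) (P Q : ProbabilityMeasure 𝒳) :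
    Measure ((Fin n → 𝒳) × (Fin n → 𝒳)) :=
  (Measure.pi fun _ : Fin n => (P : Measure 𝒳)).prod
    (Measure.pi fun _ : Fin n => (Q : Measure 𝒳))

/-- `ψ` (value `true` meaning "reject `H₀`") tests `H₀ : P = Q` against `H₁ : TV(P, Q) ≥ ε` over
the class `𝓜`, from two samples of size `n`, with worst-case error probability at most `δ`. -/
def IsTwoSampleTest {𝒳 : Type*} [MeasurableSpace 𝒳] (ε δ : ℝ) (𝓜 : Set (ProbabilityMeasure 𝒳))
    (n : ℕ) (ψ : (Fin n → 𝒳) × (Fin n → 𝒳) → Bool) : Prop :=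
  Measurable ψ ∧
    (∀ P ∈ 𝓜, (twoSampleLaw n P P).real {w | ψ w = true} ≤ δ) ∧
    (∀ P ∈ 𝓜, ∀ Q ∈ 𝓜, ε ≤ tvDist P Q → (twoSampleLaw n P Q).real {w | ψ w = false} ≤ δ)

/-- The two-sample minimax sample complexity `n_TS(ε, δ, 𝓜)`: the smallest `N` such that for every
`n ≥ N` there is a two-sample test with error at most `δ` (and `⊤` if there is no such `N`). -/
def nTS {𝒳 : Type*} [MeasurableSpace 𝒳] (ε δ : ℝ) (𝓜 : Set (ProbabilityMeasure 𝒳)) : ℕ∞ :=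
  sInf {N : ℕ∞ | ∃ N₀ : ℕ, N = (N₀ : ℕ∞) ∧ ∀ n : ℕ, N₀ ≤ n → ∃ ψ, IsTwoSampleTest ε δ 𝓜 n ψ}

/-- The Sobolev ellipsoid `{θ : ∑_{j ≥ 1} j^{2s} θ_j² ≤ C}`. Sequences are indexed from `0`: the
coordinate `θ_j` of the mathematical notation (`j ≥ 1`) is `θ (j - 1)`. -/
def sobolevEllipsoid (s C : ℝ) : Set (ℕ → ℝ) :=
  {θ | Summable (fun j : ℕ => ((j : ℝ) + 1) ^ (2 * s) * θ j ^ 2) ∧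
    ∑' j : ℕ, ((j : ℝ) + 1) ^ (2 * s) * θ j ^ 2 ≤ C}

/-- `μ_θ = ⨂_j N(θ_j, 1)` on `ℝ^ℕ`. -/
def gaussSeq (θ : ℕ → ℝ) : ProbabilityMeasure (ℕ → ℝ) :=
  ⟨Measure.infinitePi fun j => gaussianReal (θ j) 1, inferInstance⟩

/-- The class `P_G(s, C)` of Gaussian sequence models with mean in the Sobolev ellipsoid. -/
def gaussClass (s C : ℝ) : Set (ProbabilityMeasure (ℕ → ℝ)) :=
  gaussSeq '' sobolevEllipsoid s C

/-- The empirical mean vector of a sample of size `n`. -/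
def empMean {n : ℕ} (x : Fin n → ℕ → ℝ) (j : ℕ) : ℝ :=
  (∑ i, x i j) / n

/-- The truncated likelihood-ratio statistic
`T(Z) = 2 ∑_{j ≤ J} (θ̂^X_j - θ̂^Y_j) (Z_j - (θ̂^X_j + θ̂^Y_j) / 2)`. -/
def truncLR (J : ℕ) {n : ℕ} (w : (Fin n → ℕ → ℝ) × (Fin n → ℕ → ℝ)) (z : ℕ → ℝ) : ℝ :=
  2 * ∑ j ∈ Finset.range J,
    (empMean w.1 j - empMean w.2 j) * (z j - (empMean w.1 j + empMean w.2 j) / 2)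

/-- The separating set `Ŝ = {Z : T(Z) ≥ 0}` computed from the two samples `w = (X, Y)`. -/
def sepSet (J : ℕ) {n : ℕ} (w : (Fin n → ℕ → ℝ) × (Fin n → ℕ → ℝ)) : Set (ℕ → ℝ) :=
  {z | 0 ≤ truncLR J w z}

/-- The separation `P(S) - Q(S)` of a set `S`. -/
def separation {𝒳 : Type*} [MeasurableSpace 𝒳] (P Q : ProbabilityMeasure 𝒳) (S : Set 𝒳) : ℝ :=
  (P : Measure 𝒳).real S - (Q : Measure 𝒳).real S

end

/-!
The set `Ŝ` is a half-space with normal vector `D`, the truncated difference of the empirical means.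
Under a Gaussian sequence measure the projection on `D` is Gaussian, so that, with `Δ` the truncated
difference of the true means, `h = ⟨D, Δ⟩ / ‖D‖` and `m` the offset of the threshold in the
direction `D`, the separation of `Ŝ` is at least a constant times `h exp (-m²)`
(`le_separation_of_goodNoise`). It has to be shown that this is at least the target rate with
probability at least `1 - δ`.

*Lower bound on the sample size.* A two-sample test for the class distinguishes two particular
points of the ellipsoid, chosen on the segment between the two given means at distance of order `ε`,
and this forces `exp (-κ N ε²) ≤ 4 δ (1 - δ)` (`exp_le_of_isTwoSampleTest`). The inequality bounds
`δ` from below both near `0` and near `1/2`. It follows from the Hellinger affinity of the two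
sampling distributions. In infinite dimension the affinity is handled through its dual formula
(`HasAffinity`), which tensorizes without densities and passes to infinite products by martingale
convergence. The same bound shows that a total variation distance of at least `ε` forces the means
to be at distance at least `2 ε`, and the choice of `J` keeps most of it in the first `J`
coordinates. The dimension dependent term of the testing rate is not needed, since for small `n` the
target separation is only of order `√(n ε^(1/s)) ε²`.

*Upper bound on the failure probability.* The noises of the difference and of the sum of the
empirical means are independent standard Gaussian vectors (`map_noise_twoSampleLaw`). The offset `m`
depends on the second one only through its projection on `D`, so that `m`, the component of the
noise along `Δ` and the orthogonal component are independent (`map_decoupling`). Let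
`a = ‖Δ‖ √(n/2)`. The failure probability exceeds the probability `Φ(-a)` of the component along `Δ`
pointing the wrong way by at most a small multiple of `a`, because the Gaussian distribution
function is Lipschitz and the perturbation of the threshold has a small mean
(`compl_goodNoise_le_of_small`). It is also at most `5 exp (-a² / 16)` by a union bound
(`compl_goodNoise_le_of_large`). The first estimate is compared with `δ` when `a` is bounded, where
`δ` may be arbitrarily close to `1/2`, and the second one when `a` is large (`failure_le_level`).
-/

open Filter Topology
open scoped RealInnerProductSpace

/-! ### Hellinger affinity in dual form -/

/-- `HasAffinity r P Q` says that the squared Hellinger affinity `(∫ √(dP dQ))²` is at least `r`.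
It is encoded through the dual formula `(∫ √(dP dQ))² = inf_f (∫ f dP) (∫ f⁻¹ dQ)`, the infimum
being over measurable `f` bounded away from `0` and `∞`; no dominating measure is needed. -/
def HasAffinity {Ω : Type*} [MeasurableSpace Ω] (r : ℝ) (P Q : Measure Ω) : Prop :=
  ∀ (f : Ω → ℝ) (a b : ℝ), Measurable f → 0 < a → (∀ x, a ≤ f x) → (∀ x, f x ≤ b) →
    r ≤ (∫ x, f x ∂P) * ∫ x, (f x)⁻¹ ∂Q

namespace HasAffinity

variable {Ω Ω' : Type*} [MeasurableSpace Ω] [MeasurableSpace Ω']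

lemma integrable_of_bounds {P : Measure Ω} [IsFiniteMeasure P] {f : Ω → ℝ} {a b : ℝ}
    (hf : Measurable f) (ha : 0 < a) (hl : ∀ x, a ≤ f x) (hu : ∀ x, f x ≤ b) :
    Integrable f P :=
  Integrable.of_bound hf.aestronglyMeasurable b <| ae_of_all _ fun x => by
    rw [Real.norm_eq_abs, abs_of_pos (ha.trans_le (hl x))]; exact hu x

lemma integrable_inv_of_bounds {P : Measure Ω} [IsFiniteMeasure P] {f : Ω → ℝ} {a : ℝ}
    (hf : Measurable f) (ha : 0 < a) (hl : ∀ x, a ≤ f x) :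
    Integrable (fun x => (f x)⁻¹) P :=
  Integrable.of_bound hf.inv.aestronglyMeasurable a⁻¹ <| ae_of_all _ fun x => by
    rw [Real.norm_eq_abs, abs_of_pos (inv_pos.2 (ha.trans_le (hl x)))]
    exact inv_anti₀ ha (hl x)

lemma le_integral_of_bound {P : Measure Ω} [IsProbabilityMeasure P] {f : Ω → ℝ} {a : ℝ}
    (hf : Integrable f P) (hl : ∀ x, a ≤ f x) : a ≤ ∫ x, f x ∂P := by
  simpa using integral_mono (integrable_const a) hf hl

lemma integral_le_of_bound {P : Measure Ω} [IsProbabilityMeasure P] {f : Ω → ℝ} {b : ℝ}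
    (hf : Integrable f P) (hu : ∀ x, f x ≤ b) : ∫ x, f x ∂P ≤ b := by
  simpa using integral_mono hf (integrable_const b) hu

lemma mono {P Q : Measure Ω} {r r' : ℝ} (h : HasAffinity r P Q) (hr : r' ≤ r) :
    HasAffinity r' P Q :=
  fun f a b hf ha hl hu => hr.trans (h f a b hf ha hl hu)

lemma self (P : Measure Ω) [IsProbabilityMeasure P] : HasAffinity 1 P P := by
  intro f a b hf ha hl hu
  have hi := integrable_of_bounds (P := P) hf ha hl hu
  have hi' := integrable_inv_of_bounds (P := P) hf ha hl
  set m := ∫ x, f x ∂P with hm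
  have hm0 : 0 < m := ha.trans_le (le_integral_of_bound hi hl)
  have key : ∫ x, (2 / m - f x / m ^ 2) ∂P ≤ ∫ x, (f x)⁻¹ ∂P := by
    refine integral_mono ((integrable_const _).sub (hi.div_const _)) hi' fun x => ?_
    have hx : 0 < f x := ha.trans_le (hl x)
    have : 0 ≤ (f x - m) ^ 2 / (f x * m ^ 2) := by positivity
    have e : (f x - m) ^ 2 / (f x * m ^ 2) = (f x)⁻¹ - (2 / m - f x / m ^ 2) := by
      field_simp; ring
    simp only
    linarith
  rw [integral_sub (integrable_const _) (hi.div_const _), integral_div (m ^ 2), ← hm] at key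
  simp only [integral_const, probReal_univ, one_smul] at key
  have e : 2 / m - m / m ^ 2 = 1 / m := by field_simp; ring
  rw [e] at key
  calc (1 : ℝ) = m * (1 / m) := by field_simp
    _ ≤ _ := by gcongr

lemma map {P Q : Measure Ω} {r : ℝ} (h : HasAffinity r P Q) {φ : Ω → Ω'} (hφ : Measurable φ) :
    HasAffinity r (P.map φ) (Q.map φ) := by
  intro f a b hf ha hl hu
  rw [integral_map hφ.aemeasurable hf.aestronglyMeasurable,
    integral_map (f := fun x => (f x)⁻¹) hφ.aemeasurable hf.inv.aestronglyMeasurable]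
  exact h (f ∘ φ) a b (hf.comp hφ) ha (fun x => hl _) (fun x => hu _)

/-- The affinity is multiplicative: apply the bound on the second factor to each section of `f`,
then the bound on the first factor to the partial integral of `f`. -/
lemma prod {P Q : Measure Ω} {P' Q' : Measure Ω'} [IsProbabilityMeasure P] [IsProbabilityMeasure Q]
    [IsProbabilityMeasure P'] [IsProbabilityMeasure Q'] {r r' : ℝ} (h : HasAffinity r P Q)
    (h' : HasAffinity r' P' Q') (hr' : 0 ≤ r') : HasAffinity (r * r') (P.prod P') (Q.prod Q') := by
  intro f a b hf ha hl hu
  have hsec : ∀ x, Measurable fun y => f (x, y) := fun x => hf.comp measurable_prodMk_left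
  let F : Ω → ℝ := fun x => ∫ y, f (x, y) ∂P'
  have hF : Measurable F := hf.stronglyMeasurable.integral_prod_right'.measurable
  have hFl : ∀ x, a ≤ F x := fun x =>
    le_integral_of_bound (integrable_of_bounds (hsec x) ha (fun y => hl _) fun y => hu _)
      fun y => hl _
  have hFu : ∀ x, F x ≤ b := fun x =>
    integral_le_of_bound (integrable_of_bounds (hsec x) ha (fun y => hl _) fun y => hu _)
      fun y => hu _
  have e1 : ∫ z, f z ∂(P.prod P') = ∫ x, F x ∂P :=
    integral_prod _ (integrable_of_bounds hf ha hl hu)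
  have hG : Integrable (fun x => ∫ y, (f (x, y))⁻¹ ∂Q') Q :=
    (integrable_inv_of_bounds (P := Q.prod Q') hf ha hl).integral_prod_left
  have e2 : ∫ z, (f z)⁻¹ ∂(Q.prod Q') = ∫ x, ∫ y, (f (x, y))⁻¹ ∂Q' ∂Q :=
    integral_prod _ (integrable_inv_of_bounds hf ha hl)
  have hlow : ∫ x, r' * (F x)⁻¹ ∂Q ≤ ∫ x, ∫ y, (f (x, y))⁻¹ ∂Q' ∂Q := by
    refine integral_mono ((integrable_inv_of_bounds hF ha hFl).const_mul _) hG fun x => ?_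
    have h1 := h' (fun y => f (x, y)) a b (hsec x) ha (fun y => hl _) fun y => hu _
    have h2 : 0 < F x := ha.trans_le (hFl x)
    simp only
    rw [← div_eq_mul_inv, div_le_iff₀ h2, mul_comm]
    exact h1
  rw [integral_const_mul] at hlow
  have h1 := h F a b hF ha hFl hFu
  have h2 : 0 ≤ ∫ x, F x ∂P :=
    ha.le.trans (le_integral_of_bound (integrable_of_bounds hF ha hFl hFu) hFl)
  rw [e1, e2]
  calc r * r' ≤ ((∫ x, F x ∂P) * ∫ x, (F x)⁻¹ ∂Q) * r' := by gcongr
    _ = (∫ x, F x ∂P) * (r' * ∫ x, (F x)⁻¹ ∂Q) := by ring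
    _ ≤ _ := by gcongr

lemma pi_fin {n : ℕ} {X : Fin n → Type*} [∀ i, MeasurableSpace (X i)] {P Q : ∀ i, Measure (X i)}
    [∀ i, IsProbabilityMeasure (P i)] [∀ i, IsProbabilityMeasure (Q i)] {r : Fin n → ℝ}
    (hr : ∀ i, 0 ≤ r i) (h : ∀ i, HasAffinity (r i) (P i) (Q i)) :
    HasAffinity (∏ i, r i) (Measure.pi P) (Measure.pi Q) := by
  induction n with
  | zero =>
    have : P = Q := Subsingleton.elim _ _
    subst this
    simpa using self (Measure.pi P)
  | succ n ih =>
    have hP := (measurePreserving_piFinSuccAbove P 0).symm.map_eq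
    have hQ := (measurePreserving_piFinSuccAbove Q 0).symm.map_eq
    rw [Fin.prod_univ_succ, ← hP, ← hQ]
    exact ((h 0).prod (ih (fun i => hr _) fun i => h _)
      (Finset.prod_nonneg fun i _ => hr _)).map (MeasurableEquiv.measurable _)

lemma pi {ι : Type*} [Fintype ι] {X : ι → Type*} [∀ i, MeasurableSpace (X i)]
    {P Q : ∀ i, Measure (X i)} [∀ i, IsProbabilityMeasure (P i)] [∀ i, IsProbabilityMeasure (Q i)]
    {r : ι → ℝ} (hr : ∀ i, 0 ≤ r i) (h : ∀ i, HasAffinity (r i) (P i) (Q i)) :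
    HasAffinity (∏ i, r i) (Measure.pi P) (Measure.pi Q) := by
  let e := (Fintype.equivFin ι).symm
  rw [← (measurePreserving_piCongrLeft P e).map_eq, ← (measurePreserving_piCongrLeft Q e).map_eq,
    ← e.prod_comp]
  exact (pi_fin (fun i => hr _) fun i => h _).map (MeasurableEquiv.measurable _)

/-- The affinity of two laws of sequences is determined by initial segments: by Lévy's upward
theorem under `P + Q`, a bounded function of the sequence is an almost sure limit of equally
bounded functions of initial segments. -/
lemma of_frestrictLe {X : ℕ → Type*} [∀ i, MeasurableSpace (X i)] {P Q : Measure (∀ i, X i)}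
    [IsProbabilityMeasure P] [IsProbabilityMeasure Q] {r : ℝ}
    (h : ∀ n, HasAffinity r (P.map (Preorder.frestrictLe n)) (Q.map (Preorder.frestrictLe n))) :
    HasAffinity r P Q := by
  intro f a b hf ha hl hu
  let μ := P + Q
  have hPR : P ≪ μ := Measure.AbsolutelyContinuous.rfl.add_right Q
  have hQR : Q ≪ μ := by
    simpa [μ, add_comm] using (Measure.AbsolutelyContinuous.refl Q).add_right P
  let ℱ : Filtration ℕ (MeasurableSpace.pi (m := fun i => (inferInstance : MeasurableSpace (X i))))
    := Filtration.piLE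
  have hsup : ⨆ n, ℱ n = MeasurableSpace.pi := by
    refine le_antisymm (iSup_le fun n => ℱ.le n) ?_
    refine iSup_le fun i => ?_
    refine le_trans ?_ (le_iSup _ i)
    change MeasurableSpace.comap _ _ ≤ (Filtration.piLE (X := X)) i
    rw [Filtration.piLE_eq_comap_frestrictLe]
    have : (fun g : ∀ i, X i => g i) =
        (fun g : (∀ j : Finset.Iic i, X j) => g ⟨i, by simp⟩) ∘ Preorder.frestrictLe i := rfl
    rw [this, ← MeasurableSpace.comap_comp]
    exact MeasurableSpace.comap_mono (Measurable.comap_le (by fun_prop))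
  have hlim := tendsto_ae_condExp (μ := μ) (ℱ := ℱ) f
  have hid : μ[f | ⨆ n, ℱ n] = f := by
    rw [hsup]
    exact condExp_of_stronglyMeasurable le_rfl hf.stronglyMeasurable
      (integrable_of_bounds hf ha hl hu)
  rw [hid] at hlim
  have hab : a ≤ b := by
    obtain ⟨x⟩ : Nonempty (∀ i, X i) := P.nonempty_of_neZero
    exact (hl x).trans (hu x)
  let g : ℕ → (∀ i, X i) → ℝ := fun n x => max a (min b ((μ[f | ℱ n]) x))
  have hgl : ∀ n x, a ≤ g n x := fun n x => le_max_left _ _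
  have hgu : ∀ n x, g n x ≤ b := fun n x => max_le hab (min_le_left _ _)
  have hgm : ∀ n, Measurable (g n) := fun n =>
    measurable_const.max (measurable_const.min
      (stronglyMeasurable_condExp.measurable.mono (ℱ.le n) le_rfl))
  have hglim : ∀ᵐ x ∂μ, Tendsto (fun n => g n x) atTop (𝓝 (f x)) := by
    filter_upwards [hlim] with x hx
    have := (tendsto_const_nhds (x := a)).max ((tendsto_const_nhds (x := b)).min hx)
    rwa [min_eq_right (hu x), max_eq_right (hl x)] at this
  have hstep : ∀ n, r ≤ (∫ x, g n x ∂P) * ∫ x, (g n x)⁻¹ ∂Q := by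
    intro n
    have hm : Measurable[MeasurableSpace.pi.comap (Preorder.frestrictLe n)] (μ[f | ℱ n]) := by
      have := (stronglyMeasurable_condExp (μ := μ) (m := ℱ n) (f := f)).measurable
      rwa [← Filtration.piLE_eq_comap_frestrictLe]
    obtain ⟨k, hk, hk'⟩ := hm.exists_eq_measurable_comp
    let k' : (∀ i : Finset.Iic n, X i) → ℝ := fun y => max a (min b (k y))
    have hk'm : Measurable k' := measurable_const.max (measurable_const.min hk)
    have e : ∀ x, g n x = k' (Preorder.frestrictLe n x) := fun x => by
      simp only [g, k', hk', Function.comp]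
    have := h n k' a b hk'm ha (fun y => le_max_left _ _) fun y => max_le hab (min_le_left _ _)
    rw [integral_map (by fun_prop) hk'm.aestronglyMeasurable,
      integral_map (f := fun x => (k' x)⁻¹) (by fun_prop) hk'm.inv.aestronglyMeasurable] at this
    simpa only [e] using this
  have t1 : Tendsto (fun n => ∫ x, g n x ∂P) atTop (𝓝 (∫ x, f x ∂P)) := by
    refine tendsto_integral_of_dominated_convergence (fun _ => b)
      (fun n => (hgm n).aestronglyMeasurable) (integrable_const _) (fun n => ae_of_all _ fun x => ?_)
      (hPR.ae_le hglim)
    rw [Real.norm_eq_abs, abs_of_pos (ha.trans_le (hgl n x))]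
    exact hgu n x
  have t2 : Tendsto (fun n => ∫ x, (g n x)⁻¹ ∂Q) atTop (𝓝 (∫ x, (f x)⁻¹ ∂Q)) := by
    refine tendsto_integral_of_dominated_convergence (fun _ => a⁻¹)
      (fun n => (hgm n).inv.aestronglyMeasurable) (integrable_const _)
      (fun n => ae_of_all _ fun x => ?_) ?_
    · rw [Real.norm_eq_abs, abs_of_pos (inv_pos.2 (ha.trans_le (hgl n x)))]
      exact inv_anti₀ ha (hgl n x)
    · filter_upwards [hQR.ae_le hglim] with x hx
      exact hx.inv₀ (ha.trans_le (hl x)).ne'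
  exact ge_of_tendsto' (t1.mul t2) hstep

/-- A test whose two error probabilities have mean at most `m < 1/2` forces the squared affinity
below `4 m (1 - m)`: use the dual formula with `f = √((1 - m) / m)` on the rejection region and
its inverse elsewhere. -/
lemma le_of_test {P Q : Measure Ω} [IsProbabilityMeasure P] [IsProbabilityMeasure Q] {r m : ℝ}
    (h : HasAffinity r P Q) {A : Set Ω} (hA : MeasurableSet A) (hm0 : 0 < m) (hm : m ≤ 1 / 2)
    (herr : P.real A + Q.real Aᶜ ≤ 2 * m) : r ≤ 4 * m * (1 - m) := by
  classical
  set t := Real.sqrt ((1 - m) / m) with ht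
  have h1m : 0 < 1 - m := by linarith
  have ht2 : t ^ 2 = (1 - m) / m := Real.sq_sqrt (by positivity)
  have ht0 : 0 < t := Real.sqrt_pos.2 (by positivity)
  have ht1 : 1 ≤ t := by
    rw [ht]; apply Real.one_le_sqrt.2; rw [le_div_iff₀ hm0]; linarith
  have hti : t⁻¹ ≤ 1 := inv_le_one_of_one_le₀ ht1
  let f : Ω → ℝ := A.piecewise (fun _ => t) fun _ => t⁻¹
  have hfm : Measurable f := Measurable.piecewise hA measurable_const measurable_const
  have hfl : ∀ x, t⁻¹ ≤ f x := fun x => by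
    by_cases hx : x ∈ A <;> simp [f, hx]; linarith
  have hfu : ∀ x, f x ≤ t := fun x => by
    by_cases hx : x ∈ A <;> simp [f, hx]; linarith
  have key := h f t⁻¹ t hfm (by positivity) hfl hfu
  have hPc : P.real Aᶜ = 1 - P.real A := probReal_compl_eq_one_sub hA
  have hQc : Q.real Aᶜ = 1 - Q.real A := probReal_compl_eq_one_sub hA
  have e1 : ∫ x, f x ∂P = t * P.real A + t⁻¹ * (1 - P.real A) := by
    have : f = fun x => A.indicator (fun _ => t) x + Aᶜ.indicator (fun _ => t⁻¹) x := by
      ext x; by_cases hx : x ∈ A <;> simp [f, hx]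
    rw [this, integral_add ((integrable_const _).indicator hA)
      ((integrable_const _).indicator hA.compl), integral_indicator_const _ hA,
      integral_indicator_const _ hA.compl, hPc]
    simp [mul_comm]
  have e2 : ∫ x, (f x)⁻¹ ∂Q = t⁻¹ * (1 - Q.real Aᶜ) + t * Q.real Aᶜ := by
    have : (fun x => (f x)⁻¹) =
        fun x => A.indicator (fun _ => t⁻¹) x + Aᶜ.indicator (fun _ => t) x := by
      ext x; by_cases hx : x ∈ A <;> simp [f, hx]
    rw [this, integral_add ((integrable_const _).indicator hA)
      ((integrable_const _).indicator hA.compl), integral_indicator_const _ hA,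
      integral_indicator_const _ hA.compl, hQc]
    simp [mul_comm]
  set α := P.real A
  set β := Q.real Aᶜ
  rw [e1, e2] at key
  have hs : (t * α + t⁻¹ * (1 - α)) + (t⁻¹ * (1 - β) + t * β) ≤ 2 * (t * m + t⁻¹ * (1 - m)) := by
    nlinarith [mul_nonneg (sub_nonneg.2 herr) (sub_nonneg.2 (hti.trans ht1))]
  have hs0 : 0 ≤ (t * α + t⁻¹ * (1 - α)) + (t⁻¹ * (1 - β) + t * β) := by
    have a1 : 0 ≤ α := measureReal_nonneg
    have a2 : α ≤ 1 := measureReal_le_one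
    have b1 : 0 ≤ β := measureReal_nonneg
    have b2 : β ≤ 1 := measureReal_le_one
    have := sub_nonneg.2 a2
    have := sub_nonneg.2 b2
    positivity
  have hsq : (t * m + t⁻¹ * (1 - m)) ^ 2 = 4 * m * (1 - m) := by
    have : t⁻¹ ^ 2 = m / (1 - m) := by rw [inv_pow, ht2, inv_div]
    have h' : t * t⁻¹ = 1 := mul_inv_cancel₀ ht0.ne'
    calc (t * m + t⁻¹ * (1 - m)) ^ 2
        = t ^ 2 * m ^ 2 + 2 * (t * t⁻¹) * (m * (1 - m)) + t⁻¹ ^ 2 * (1 - m) ^ 2 := by ring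
      _ = _ := by rw [ht2, this, h']; field_simp; ring
  set u := t * α + t⁻¹ * (1 - α)
  set v := t⁻¹ * (1 - β) + t * β
  calc r ≤ u * v := key
    _ ≤ ((u + v) / 2) ^ 2 := by nlinarith [sq_nonneg (u - v)]
    _ ≤ (t * m + t⁻¹ * (1 - m)) ^ 2 := by
        apply pow_le_pow_left₀ (by linarith); linarith
    _ = _ := hsq

/-- Two unit-variance Gaussians: the geometric mean of the densities is `exp (-(a - b)² / 8)` times
the density centred at the midpoint. -/
lemma gaussianReal (a b : ℝ) :
    HasAffinity (Real.exp (-(a - b) ^ 2 / 4)) (ProbabilityTheory.gaussianReal a 1)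
      (ProbabilityTheory.gaussianReal b 1) := by
  intro f l u hf hl0 hl hu
  have hi := integrable_of_bounds (P := ProbabilityTheory.gaussianReal a 1) hf hl0 hl hu
  have hi' := integrable_inv_of_bounds (P := ProbabilityTheory.gaussianReal b 1) hf hl0 hl
  set m := ∫ x, f x ∂(ProbabilityTheory.gaussianReal a 1) with hm
  have hm0 : 0 < m := hl0.trans_le (le_integral_of_bound hi hl)
  set ρ := Real.exp (-(a - b) ^ 2 / 8) with hρ
  let p := gaussianPDFReal a 1
  let q := gaussianPDFReal b 1
  let c := gaussianPDFReal ((a + b) / 2) 1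
  have hpq : ∀ x, p x * q x = (ρ * c x) ^ 2 := by
    intro x
    simp only [p, q, c, gaussianPDFReal, hρ, mul_pow, ← Real.exp_nat_mul]
    have : ∀ k A B C : ℝ, Real.exp A * Real.exp B = Real.exp C →
        k * Real.exp A * (k * Real.exp B) = k ^ 2 * Real.exp C := by
      intro k A B C h; rw [← h]; ring
    rw [this _ _ _ (2 * (-(a - b) ^ 2 / 8) + 2 * (-(x - (a + b) / 2) ^ 2 / 2))]
    · rw [Real.exp_add]; push_cast; ring_nf
    · rw [← Real.exp_add]; congr 1; push_cast; ring
  have hmf : m = ∫ x, p x * f x := by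
    rw [hm, integral_gaussianReal_eq_integral_smul one_ne_zero]; rfl
  have hqf : ∫ x, (f x)⁻¹ ∂(ProbabilityTheory.gaussianReal b 1) = ∫ x, q x * (f x)⁻¹ := by
    rw [integral_gaussianReal_eq_integral_smul one_ne_zero]; rfl
  have ip : Integrable (fun x => p x * f x) := by
    refine (integrable_gaussianPDFReal a 1).mul_bdd (c := u) hf.aestronglyMeasurable ?_
    exact ae_of_all _ fun x => by
      rw [Real.norm_eq_abs, abs_of_pos (hl0.trans_le (hl x))]; exact hu x
  have iq : Integrable (fun x => q x * (f x)⁻¹) := by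
    refine (integrable_gaussianPDFReal b 1).mul_bdd (c := l⁻¹) hf.inv.aestronglyMeasurable ?_
    exact ae_of_all _ fun x => by
      rw [Real.norm_eq_abs, abs_of_pos (inv_pos.2 (hl0.trans_le (hl x)))]
      exact inv_anti₀ hl0 (hl x)
  have ic : Integrable c := integrable_gaussianPDFReal _ _
  have key : ∫ x, ((2 * ρ ^ 2 / m) * c x - (ρ ^ 2 / m ^ 2) * (p x * f x)) ≤
      ∫ x, q x * (f x)⁻¹ := by
    refine integral_mono ((ic.const_mul _).sub (ip.const_mul _)) iq fun x => ?_
    have hx : 0 < f x := hl0.trans_le (hl x)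
    have hp : 0 < p x := gaussianPDFReal_pos _ _ _ one_ne_zero
    have e : q x = (ρ * c x) ^ 2 / p x := by rw [← hpq]; field_simp
    have h0 : 0 ≤ ρ ^ 2 * (p x * f x - m * c x) ^ 2 / (p x * f x * m ^ 2) := by positivity
    have e2 : ρ ^ 2 * (p x * f x - m * c x) ^ 2 / (p x * f x * m ^ 2) =
        (ρ * c x) ^ 2 / p x * (f x)⁻¹ -
          ((2 * ρ ^ 2 / m) * c x - (ρ ^ 2 / m ^ 2) * (p x * f x)) := by
      field_simp; ring
    simp only
    rw [e]
    linarith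
  rw [integral_sub (ic.const_mul _) (ip.const_mul _), integral_const_mul, integral_const_mul,
    ← hmf, integral_gaussianPDFReal_eq_one _ one_ne_zero] at key
  have e : 2 * ρ ^ 2 / m * 1 - ρ ^ 2 / m ^ 2 * m = ρ ^ 2 / m := by field_simp; ring
  rw [e, div_le_iff₀ hm0] at key
  rw [hqf, mul_comm]
  refine le_trans (le_of_eq ?_) key
  rw [hρ, ← Real.exp_nat_mul]; congr 1; push_cast; ring

end HasAffinity

/-- The squared affinity of two Gaussian sequence measures is at least `exp (-‖θ - θ'‖² / 4)`. -/
lemma hasAffinity_gaussSeq {θ θ' : ℕ → ℝ} (h : Summable fun j => (θ j - θ' j) ^ 2) :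
    HasAffinity (Real.exp (-(∑' j, (θ j - θ' j) ^ 2) / 4))
      (gaussSeq θ : Measure (ℕ → ℝ)) (gaussSeq θ') := by
  apply HasAffinity.of_frestrictLe
  intro n
  change HasAffinity _
    ((Measure.infinitePi fun j => gaussianReal (θ j) 1).map (Finset.Iic n).restrict)
    ((Measure.infinitePi fun j => gaussianReal (θ' j) 1).map (Finset.Iic n).restrict)
  rw [Measure.infinitePi_map_restrict, Measure.infinitePi_map_restrict]
  refine (HasAffinity.pi (fun i => (Real.exp_pos _).le)
    fun i : Finset.Iic n => HasAffinity.gaussianReal (θ i) (θ' i)).mono ?_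
  rw [← Real.exp_sum, Real.exp_le_exp,
    Finset.sum_coe_sort (Finset.Iic n) fun i => -(θ i - θ' i) ^ 2 / 4, ← Finset.sum_div,
    Finset.sum_neg_distrib]
  have := h.sum_le_tsum (Finset.Iic n) fun i _ => sq_nonneg _
  linarith

lemma hasAffinity_twoSampleLaw {n : ℕ} {θ θ' : ℕ → ℝ} (h : Summable fun j => (θ j - θ' j) ^ 2) :
    HasAffinity (Real.exp (-(n * ∑' j, (θ j - θ' j) ^ 2) / 4))
      (twoSampleLaw n (gaussSeq θ) (gaussSeq θ)) (twoSampleLaw n (gaussSeq θ) (gaussSeq θ')) := by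
  have h1 := HasAffinity.pi (ι := Fin n) (fun i => (Real.exp_pos _).le)
    fun _ => hasAffinity_gaussSeq h
  have h2 := (HasAffinity.self (Measure.pi fun _ : Fin n => (gaussSeq θ : Measure (ℕ → ℝ)))).prod h1
    (Finset.prod_nonneg fun i _ => (Real.exp_pos _).le)
  refine h2.mono (le_of_eq ?_)
  rw [Finset.prod_const, Finset.card_univ, Fintype.card_fin, ← Real.exp_nat_mul, one_mul]
  congr 1; ring

/-! ### Half-spaces under Gaussian sequence measures -/

/-- The first `J` coordinates of a sequence, as a Euclidean vector. -/
noncomputable def head (J : ℕ) (z : ℕ → ℝ) : EuclideanSpace ℝ (Fin J) :=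
  WithLp.toLp 2 fun j => z j

lemma measurable_head (J : ℕ) : Measurable (head J) := by
  unfold head; fun_prop

/-- The first coordinates of a Gaussian sequence form a translated standard Gaussian vector. -/
lemma map_head_gaussSeq (J : ℕ) (θ : ℕ → ℝ) :
    (gaussSeq θ : Measure (ℕ → ℝ)).map (head J) =
      (stdGaussian (EuclideanSpace ℝ (Fin J))).map fun x => head J θ + x := by
  have h1 : (gaussSeq θ : Measure (ℕ → ℝ)).map (fun z (j : Fin J) => z j) =
      Measure.pi fun j : Fin J => gaussianReal (θ j) 1 := by
    have hi : iIndepFun (fun (j : ℕ) (z : ℕ → ℝ) => z j)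
        (Measure.infinitePi fun j => gaussianReal (θ j) 1) :=
      iIndepFun_infinitePi (X := fun _ x => x) fun _ => measurable_id
    have hi' := hi.precomp (g := fun j : Fin J => (j : ℕ)) Fin.val_injective
    rw [iIndepFun_iff_map_fun_eq_pi_map fun i => (measurable_pi_apply _).aemeasurable] at hi'
    refine hi'.trans ?_
    congr 1; ext1 j
    exact Measure.infinitePi_map_eval (fun j => gaussianReal (θ j) 1) j
  have h2 : (gaussSeq θ : Measure (ℕ → ℝ)).map (head J) =
      (Measure.pi fun j : Fin J => gaussianReal (θ j) 1).map (WithLp.toLp 2) := by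
    rw [← h1, Measure.map_map (by fun_prop) (by fun_prop)]; rfl
  have h3 : (Measure.pi fun j : Fin J => gaussianReal (θ j) 1) =
      (Measure.pi fun _ : Fin J => gaussianReal 0 1).map fun x (j : Fin J) => θ j + x j := by
    have : ∀ j : Fin J, SigmaFinite ((gaussianReal 0 1).map fun x => θ j + x) := fun j => by
      rw [gaussianReal_map_const_add]; infer_instance
    rw [Measure.pi_map_pi (μ := fun _ : Fin J => gaussianReal 0 1)
      (f := fun (j : Fin J) x => θ j + x) fun i => by fun_prop]
    simp only [gaussianReal_map_const_add, zero_add]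
  rw [h2, h3, ← map_pi_eq_stdGaussian, Measure.map_map (by fun_prop) (by fun_prop),
    Measure.map_map (by fun_prop) (by fun_prop)]
  rfl

lemma map_inner_stdGaussian {E : Type*} [NormedAddCommGroup E] [InnerProductSpace ℝ E]
    [FiniteDimensional ℝ E] [MeasurableSpace E] [BorelSpace E] {e : E} (he : ‖e‖ = 1) :
    (stdGaussian E).map (fun x => ⟪e, x⟫) = gaussianReal 0 1 := by
  have h := IsGaussian.map_eq_gaussianReal (μ := stdGaussian E) (innerSL ℝ e)
  rw [variance_dual_stdGaussian, integral_strongDual_stdGaussian, innerSL_apply_norm, he] at h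
  simpa using h

lemma gaussianReal_real_Ico {a b : ℝ} (hab : a ≤ b) :
    (gaussianReal 0 1).real (Set.Ico a b) = ∫ x in a..b, gaussianPDFReal 0 1 x := by
  rw [measureReal_def, gaussianReal_apply_eq_integral _ one_ne_zero, ENNReal.toReal_ofReal
    (integral_nonneg fun x => gaussianPDFReal_nonneg _ _ _), intervalIntegral.integral_of_le hab,
    integral_Ico_eq_integral_Ioc]

lemma gaussianPDFReal_anti {x R : ℝ} (h : |x| ≤ R) :
    gaussianPDFReal 0 1 R ≤ gaussianPDFReal 0 1 x := by
  simp only [gaussianPDFReal, sub_zero]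
  have : x ^ 2 ≤ R ^ 2 := (sq_abs x).symm.trans_le (pow_le_pow_left₀ (abs_nonneg x) h 2)
  gcongr

lemma gaussianPDFReal_le_one (x : ℝ) : gaussianPDFReal 0 1 x ≤ 1 := by
  refine (gaussianPDFReal_anti (R := |x|) le_rfl |>.trans ?_ : gaussianPDFReal 0 1 |x| ≤ 1) |>.trans' ?_
  · simp only [gaussianPDFReal, sub_zero, NNReal.coe_one, mul_one]
    have h1 : 1 ≤ Real.sqrt (2 * Real.pi) :=
      Real.one_le_sqrt.2 (by nlinarith [Real.pi_gt_three])
    have h2 : Real.exp (-x ^ 2 / 2) ≤ 1 := Real.exp_le_one_iff.2 (by nlinarith [sq_nonneg x])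
    calc (Real.sqrt (2 * Real.pi))⁻¹ * Real.exp (-x ^ 2 / 2) ≤ 1 * 1 := by
          gcongr
          exact inv_le_one_of_one_le₀ h1
      _ = 1 := one_mul 1
  · simp only [gaussianPDFReal, sub_zero, sq_abs]; exact le_rfl

lemma continuous_gaussianPDFReal : Continuous (gaussianPDFReal 0 1) := by
  unfold gaussianPDFReal; fun_prop

lemma mul_pdf_le_gaussianReal_Ico {a b R : ℝ} (hab : a ≤ b) (ha : -R ≤ a) (hb : b ≤ R) :
    (b - a) * gaussianPDFReal 0 1 R ≤ (gaussianReal 0 1).real (Set.Ico a b) := by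
  rw [gaussianReal_real_Ico hab]
  have := intervalIntegral.integral_mono_on (μ := volume) hab
    (continuous_const (y := gaussianPDFReal 0 1 R).intervalIntegrable a b)
    (continuous_gaussianPDFReal.intervalIntegrable a b)
    fun x hx => gaussianPDFReal_anti (abs_le.2 ⟨ha.trans hx.1, hx.2.trans hb⟩)
  simpa using this

lemma gaussianReal_Ico_le {a b : ℝ} (hab : a ≤ b) :
    (gaussianReal 0 1).real (Set.Ico a b) ≤ b - a := by
  rw [gaussianReal_real_Ico hab]
  have := intervalIntegral.integral_mono_on (μ := volume) hab (continuous_gaussianPDFReal.intervalIntegrable a b)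
    (continuous_const (y := (1 : ℝ)).intervalIntegrable a b) fun x _ => gaussianPDFReal_le_one x
  simpa using this

/-- The probability of a half-space under a Gaussian sequence measure. -/
lemma gaussSeq_real_halfSpace {J : ℕ} (θ : ℕ → ℝ) {D : EuclideanSpace ℝ (Fin J)} (hD : D ≠ 0)
    (t : ℝ) : (gaussSeq θ : Measure (ℕ → ℝ)).real {z | t ≤ ⟪D, head J z⟫} =
      (gaussianReal 0 1).real (Set.Ici ((t - ⟪D, head J θ⟫) / ‖D‖)) := by
  have hn : 0 < ‖D‖ := norm_pos_iff.2 hD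
  have hm : MeasurableSet {x : EuclideanSpace ℝ (Fin J) | t ≤ ⟪D, x⟫} :=
    measurableSet_le measurable_const (by fun_prop)
  have h1 : {z | t ≤ ⟪D, head J z⟫} = head J ⁻¹' {x | t ≤ ⟪D, x⟫} := rfl
  rw [h1, ← map_measureReal_apply (measurable_head J) hm, map_head_gaussSeq,
    map_measureReal_apply (by fun_prop) hm,
    ← map_inner_stdGaussian (E := EuclideanSpace ℝ (Fin J)) (e := ‖D‖⁻¹ • D)
      (by rw [norm_smul, norm_inv, norm_norm, inv_mul_cancel₀ hn.ne']),
    map_measureReal_apply (by fun_prop) measurableSet_Ici]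
  congr 1; ext x
  simp only [Set.mem_preimage, Set.mem_ofPred_eq, Set.mem_Ici, inner_add_right, inner_smul_left,
    RCLike.conj_to_real]
  rw [div_le_iff₀ hn, inv_mul_eq_div, div_mul_cancel₀ _ hn.ne', sub_le_iff_le_add']

/-- A half-space with normal `D` separates two Gaussian sequence measures by at least the distance
of the projected means times the smallest Gaussian density between the two thresholds. -/
lemma le_separation_halfSpace {J : ℕ} (θ θ' : ℕ → ℝ) {D : EuclideanSpace ℝ (Fin J)} (hD : D ≠ 0)
    (t : ℝ) {h m : ℝ} (hh : ⟪D, head J θ⟫ - ⟪D, head J θ'⟫ = h * ‖D‖)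
    (hm : (⟪D, head J θ⟫ + ⟪D, head J θ'⟫) / 2 - t = m * ‖D‖) (hh0 : 0 ≤ h) :
    h * gaussianPDFReal 0 1 (|m| + h / 2) ≤
      separation (gaussSeq θ) (gaussSeq θ') {z | t ≤ ⟪D, head J z⟫} := by
  have hn : 0 < ‖D‖ := norm_pos_iff.2 hD
  have ea : (t - ⟪D, head J θ⟫) / ‖D‖ = -m - h / 2 := by
    rw [div_eq_iff hn.ne']; linarith
  have eb : (t - ⟪D, head J θ'⟫) / ‖D‖ = -m + h / 2 := by
    rw [div_eq_iff hn.ne']; linarith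
  have hab : -m - h / 2 ≤ -m + h / 2 := by linarith
  have hI : Set.Ici (-m - h / 2) \ Set.Ici (-m + h / 2) = Set.Ico (-m - h / 2) (-m + h / 2) := by
    ext x; simp
  rw [separation, gaussSeq_real_halfSpace θ hD, gaussSeq_real_halfSpace θ' hD, ea, eb,
    ← measureReal_sdiff (Set.Ici_subset_Ici.2 hab) measurableSet_Ici, hI]
  refine le_trans (le_of_eq ?_) (mul_pdf_le_gaussianReal_Ico hab (R := |m| + h / 2) ?_ ?_)
  · ring
  · linarith [le_abs_self m]
  · linarith [neg_abs_le m]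

lemma measurableSet_halfSpace {J : ℕ} (D : EuclideanSpace ℝ (Fin J)) (t : ℝ) :
    MeasurableSet {z : ℕ → ℝ | t ≤ ⟪D, head J z⟫} :=
  measurableSet_le measurable_const (Measurable.const_inner (measurable_head J))

/-! ### Total variation -/

lemma bddAbove_tvDist {Ω : Type*} [MeasurableSpace Ω] (P Q : ProbabilityMeasure Ω) :
    BddAbove (Set.range fun A : {A : Set Ω // MeasurableSet A} =>
      |(P : Measure Ω).real A.1 - (Q : Measure Ω).real A.1|) := by
  refine ⟨1, ?_⟩
  rintro _ ⟨A, rfl⟩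
  have h1 : 0 ≤ (P : Measure Ω).real A.1 := measureReal_nonneg
  have h2 : (P : Measure Ω).real A.1 ≤ 1 := measureReal_le_one
  have h3 : 0 ≤ (Q : Measure Ω).real A.1 := measureReal_nonneg
  have h4 : (Q : Measure Ω).real A.1 ≤ 1 := measureReal_le_one
  exact abs_le.2 ⟨by linarith, by linarith⟩

lemma separation_le_tvDist {Ω : Type*} [MeasurableSpace Ω] (P Q : ProbabilityMeasure Ω) {A : Set Ω}
    (hA : MeasurableSet A) : separation P Q A ≤ tvDist P Q :=
  (le_abs_self _).trans (le_ciSup (bddAbove_tvDist P Q) ⟨A, hA⟩)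

lemma HasAffinity.le_one_sub_sq_tvDist {Ω : Type*} [MeasurableSpace Ω] {P Q : ProbabilityMeasure Ω}
    {r : ℝ} (h : HasAffinity r (P : Measure Ω) Q) : r ≤ 1 - tvDist P Q ^ 2 := by
  have key : ∀ (A : Set Ω), MeasurableSet A → ∀ d : ℝ, 0 < d →
      d ≤ (Q : Measure Ω).real A - (P : Measure Ω).real A → d < 1 → r ≤ 1 - d ^ 2 := by
    intro A hA d hd hdA hd1
    have hQ : (Q : Measure Ω).real Aᶜ = 1 - (Q : Measure Ω).real A := probReal_compl_eq_one_sub hA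
    have := h.le_of_test hA (m := (1 - d) / 2) (by linarith) (by linarith) (by rw [hQ]; linarith)
    nlinarith
  have key2 : ∀ d : ℝ, 0 < d → d < tvDist P Q → r ≤ 1 - d ^ 2 := by
    intro d hd hlt
    obtain ⟨A, hA⟩ := exists_lt_of_lt_ciSup hlt
    have hd1 : d < 1 := by
      have h1 : 0 ≤ (P : Measure Ω).real A.1 := measureReal_nonneg
      have h2 : (P : Measure Ω).real A.1 ≤ 1 := measureReal_le_one
      have h3 : 0 ≤ (Q : Measure Ω).real A.1 := measureReal_nonneg
      have h4 : (Q : Measure Ω).real A.1 ≤ 1 := measureReal_le_one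
      exact hA.trans_le (abs_le.2 ⟨by linarith, by linarith⟩)
    rcases lt_abs.1 hA with hA | hA
    · refine key A.1ᶜ A.2.compl d hd ?_ hd1
      rw [probReal_compl_eq_one_sub A.2, probReal_compl_eq_one_sub A.2]; linarith
    · exact key A.1 A.2 d hd (by linarith) hd1
  have h0 : 0 ≤ tvDist P Q := Real.iSup_nonneg fun _ => abs_nonneg _
  rcases h0.eq_or_lt with h0 | h0
  · rw [← h0]
    have := h (fun _ => 1) 1 1 measurable_const one_pos (fun _ => le_rfl) fun _ => le_rfl
    simpa using this
  · have ht : Tendsto (fun d : ℝ => 1 - d ^ 2) (𝓝[<] (tvDist P Q)) (𝓝 (1 - tvDist P Q ^ 2)) :=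
      (Continuous.tendsto (by fun_prop) _).mono_left nhdsWithin_le_nhds
    refine ge_of_tendsto ht ?_
    filter_upwards [Ioo_mem_nhdsLT h0] with d hd
    exact key2 d hd.1 hd.2

/-- If the total variation distance is at least `ε`, the means are at distance at least `2 ε`. -/
lemma four_mul_sq_le_of_le_tvDist {θ θ' : ℕ → ℝ} (h : Summable fun j => (θ j - θ' j) ^ 2) {ε : ℝ}
    (hε : 0 ≤ ε) (htv : ε ≤ tvDist (gaussSeq θ) (gaussSeq θ')) :
    4 * ε ^ 2 ≤ ∑' j, (θ j - θ' j) ^ 2 := by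
  have h1 := (hasAffinity_gaussSeq h).le_one_sub_sq_tvDist
  have h2 : ε ^ 2 ≤ tvDist (gaussSeq θ) (gaussSeq θ') ^ 2 := pow_le_pow_left₀ hε htv 2
  have h3 := Real.add_one_le_exp (-(∑' j, (θ j - θ' j) ^ 2) / 4)
  linarith

/-! ### The noise in the empirical means -/

section Rotation

variable {E : Type*} [NormedAddCommGroup E] [InnerProductSpace ℝ E] [FiniteDimensional ℝ E]
  [MeasurableSpace E] [BorelSpace E]

/-- Rotating a pair of independent standard Gaussian vectors by `45` degrees. -/
lemma map_rotation_stdGaussian_prod :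
    ((stdGaussian E).prod (stdGaussian E)).map
      (fun p => ((√2)⁻¹ • (p.1 - p.2), (√2)⁻¹ • (p.1 + p.2))) =
      (stdGaussian E).prod (stdGaussian E) := by
  rw [← charFun_eq_prod_iff]
  intro t
  rw [Measure.map_map (by fun_prop) (by fun_prop), charFun_apply,
    integral_map (by fun_prop) (by fun_prop)]
  set c := (√2)⁻¹ with hc
  have hc2 : c ^ 2 = 1 / 2 := by rw [hc, inv_pow, Real.sq_sqrt (by norm_num)]; norm_num
  have e : ∀ p : E × E, Complex.exp ((⟪((WithLp.toLp 2 ∘ fun p : E × E =>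
      (c • (p.1 - p.2), c • (p.1 + p.2))) p), t⟫ : ℝ) * Complex.I) =
      Complex.exp ((⟪p.1, c • (t.ofLp.1 + t.ofLp.2)⟫ : ℝ) * Complex.I) *
        Complex.exp ((⟪p.2, c • (t.ofLp.2 - t.ofLp.1)⟫ : ℝ) * Complex.I) := by
    intro p
    rw [← Complex.exp_add, ← add_mul, ← Complex.ofReal_add]
    congr 3
    simp only [Function.comp, WithLp.prod_inner_apply, inner_smul_left, inner_smul_right,
      inner_add_left, inner_sub_left, inner_add_right, inner_sub_right, RCLike.conj_to_real]
    ring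
  simp_rw [e]
  rw [integral_prod_mul (fun x : E => Complex.exp ((⟪x, c • (t.ofLp.1 + t.ofLp.2)⟫ : ℝ) * Complex.I))
    (fun x : E => Complex.exp ((⟪x, c • (t.ofLp.2 - t.ofLp.1)⟫ : ℝ) * Complex.I)),
    ← charFun_apply, ← charFun_apply, charFun_stdGaussian, charFun_stdGaussian,
    charFun_stdGaussian, charFun_stdGaussian, ← Complex.exp_add, ← Complex.exp_add]
  congr 1
  have h1 : ‖c • (t.ofLp.1 + t.ofLp.2)‖ ^ 2 + ‖c • (t.ofLp.2 - t.ofLp.1)‖ ^ 2 =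
      ‖t.ofLp.1‖ ^ 2 + ‖t.ofLp.2‖ ^ 2 := by
    rw [norm_smul, norm_smul, mul_pow, mul_pow, Real.norm_eq_abs, sq_abs, hc2,
      norm_add_sq_real, norm_sub_sq_real, real_inner_comm]
    ring
  have h2 : ((‖c • (t.ofLp.1 + t.ofLp.2)‖ ^ 2 + ‖c • (t.ofLp.2 - t.ofLp.1)‖ ^ 2 : ℝ) : ℂ) =
      ((‖t.ofLp.1‖ ^ 2 + ‖t.ofLp.2‖ ^ 2 : ℝ) : ℂ) := by rw [h1]
  push_cast at h2
  linear_combination (-1 / 2) * h2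

end Rotation

lemma measurable_empMean {n : ℕ} : Measurable fun x : Fin n → ℕ → ℝ => empMean x := by
  unfold empMean; fun_prop

lemma measurable_head_empMean (J : ℕ) {n : ℕ} :
    Measurable fun x : Fin n → ℕ → ℝ => head J (empMean x) :=
  (measurable_head J).comp measurable_empMean

lemma measurable_empMean_deviation (J : ℕ) {n : ℕ} (θ : ℕ → ℝ) :
    Measurable fun x : Fin n → ℕ → ℝ => √n • (head J (empMean x) - head J θ) := by
  have := measurable_head_empMean J (n := n)
  fun_prop

lemma head_empMean {n : ℕ} (J : ℕ) (x : Fin n → ℕ → ℝ) :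
    head J (empMean x) = (n : ℝ)⁻¹ • ∑ i, head J (x i) := by
  ext j
  simp [head, empMean, div_eq_inv_mul]

/-- The normalized deviation of the empirical mean from the true mean is standard Gaussian. -/
lemma map_empMean_deviation {n : ℕ} (hn : n ≠ 0) (J : ℕ) (θ : ℕ → ℝ) :
    (Measure.pi fun _ : Fin n => (gaussSeq θ : Measure (ℕ → ℝ))).map
      (fun x => √n • (head J (empMean x) - head J θ)) =
      stdGaussian (EuclideanSpace ℝ (Fin J)) := by
  have hmeas := measurable_empMean_deviation J (n := n) θ
  have := Measure.isProbabilityMeasure_map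
    (μ := Measure.pi fun _ : Fin n => (gaussSeq θ : Measure (ℕ → ℝ))) hmeas.aemeasurable
  apply Measure.ext_of_charFun
  ext t
  rw [charFun_apply, integral_map hmeas.aemeasurable (by fun_prop)]
  have hn0 : (n : ℝ) ≠ 0 := Nat.cast_ne_zero.2 hn
  have hs : √(n : ℝ) * √n = n := Real.mul_self_sqrt n.cast_nonneg
  have hs0 : √(n : ℝ) ≠ 0 := fun h => hn0 (by rw [← hs, h, zero_mul])
  have e : ∀ x : Fin n → ℕ → ℝ,
      Complex.exp ((⟪√n • (head J (empMean x) - head J θ), t⟫ : ℝ) * Complex.I) =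
      ∏ i, Complex.exp ((⟪head J (x i) - head J θ, (√n)⁻¹ • t⟫ : ℝ) * Complex.I) := by
    intro x
    rw [← Complex.exp_sum, ← Finset.sum_mul, ← Complex.ofReal_sum, ← sum_inner,
      Finset.sum_sub_distrib, Finset.sum_const, Finset.card_univ, Fintype.card_fin,
      ← Nat.cast_smul_eq_nsmul ℝ, head_empMean]
    congr 3
    simp only [inner_smul_left, inner_smul_right, inner_sub_left, RCLike.conj_to_real]
    field_simp
    rw [pow_two, hs]
  simp_rw [e]
  rw [integral_fintype_prod_eq_pow (ι := Fin n)
    (f := fun z : ℕ → ℝ => Complex.exp ((⟪head J z - head J θ, (√n)⁻¹ • t⟫ : ℝ) * Complex.I)),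
    Fintype.card_fin]
  have e2 : ∫ z, Complex.exp ((⟪head J z - head J θ, (√n)⁻¹ • t⟫ : ℝ) * Complex.I)
      ∂(gaussSeq θ : Measure (ℕ → ℝ)) = charFun (stdGaussian _) ((√n)⁻¹ • t) := by
    rw [← integral_map (μ := (gaussSeq θ : Measure (ℕ → ℝ))) (φ := head J)
      (f := fun y => Complex.exp ((⟪y - head J θ, (√n)⁻¹ • t⟫ : ℝ) * Complex.I))
      (measurable_head J).aemeasurable (by fun_prop), map_head_gaussSeq,
      integral_map (by fun_prop) (by fun_prop), charFun_apply]
    simp only [add_sub_cancel_left]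
  rw [e2, charFun_stdGaussian, charFun_stdGaussian, ← Complex.exp_nat_mul]
  congr 1
  have h1 : (n : ℝ) * ‖(√(n : ℝ))⁻¹ • t‖ ^ 2 = ‖t‖ ^ 2 := by
    rw [norm_smul, mul_pow, norm_inv, inv_pow, Real.norm_eq_abs, sq_abs,
      Real.sq_sqrt n.cast_nonneg]
    field_simp
  have h2 : (((n : ℝ) * ‖(√(n : ℝ))⁻¹ • t‖ ^ 2 : ℝ) : ℂ) = ((‖t‖ ^ 2 : ℝ) : ℂ) := by rw [h1]
  push_cast at h2
  linear_combination (-1 / 2) * h2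

/-- The normalized noise in the difference of the two empirical means. -/
noncomputable def diffNoise (J : ℕ) {n : ℕ} (θ θ' : ℕ → ℝ)
    (w : (Fin n → ℕ → ℝ) × (Fin n → ℕ → ℝ)) : EuclideanSpace ℝ (Fin J) :=
  √(n / 2) • ((head J (empMean w.1) - head J (empMean w.2)) - (head J θ - head J θ'))

/-- The normalized noise in the sum of the two empirical means. -/
noncomputable def sumNoise (J : ℕ) {n : ℕ} (θ θ' : ℕ → ℝ)
    (w : (Fin n → ℕ → ℝ) × (Fin n → ℕ → ℝ)) : EuclideanSpace ℝ (Fin J) :=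
  √(n / 2) • ((head J (empMean w.1) + head J (empMean w.2)) - (head J θ + head J θ'))

lemma measurable_noise (J : ℕ) {n : ℕ} (θ θ' : ℕ → ℝ) :
    Measurable fun w : (Fin n → ℕ → ℝ) × (Fin n → ℕ → ℝ) =>
      (diffNoise J θ θ' w, sumNoise J θ θ' w) := by
  have h1 : Measurable fun w : (Fin n → ℕ → ℝ) × (Fin n → ℕ → ℝ) => head J (empMean w.1) :=
    (measurable_head J).comp (measurable_empMean.comp measurable_fst)
  have h2 : Measurable fun w : (Fin n → ℕ → ℝ) × (Fin n → ℕ → ℝ) => head J (empMean w.2) :=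
    (measurable_head J).comp (measurable_empMean.comp measurable_snd)
  unfold diffNoise sumNoise
  fun_prop

/-- The noises in the difference and in the sum of the two empirical means are independent
standard Gaussian vectors. -/
lemma map_noise_twoSampleLaw {n : ℕ} (hn : n ≠ 0) (J : ℕ) (θ θ' : ℕ → ℝ) :
    (twoSampleLaw n (gaussSeq θ) (gaussSeq θ')).map
      (fun w => (diffNoise J θ θ' w, sumNoise J θ θ' w)) =
      (stdGaussian (EuclideanSpace ℝ (Fin J))).prod (stdGaussian (EuclideanSpace ℝ (Fin J))) := by
  have key : (stdGaussian (EuclideanSpace ℝ (Fin J))).prod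
      (stdGaussian (EuclideanSpace ℝ (Fin J))) =
      (twoSampleLaw n (gaussSeq θ) (gaussSeq θ')).map
        (Prod.map (fun x => √n • (head J (empMean x) - head J θ))
          fun x => √n • (head J (empMean x) - head J θ')) := by
    rw [twoSampleLaw, ← Measure.map_prod_map _ _ (measurable_empMean_deviation J θ)
      (measurable_empMean_deviation J θ'), map_empMean_deviation hn, map_empMean_deviation hn]
  rw [← map_rotation_stdGaussian_prod, key, Measure.map_map (by fun_prop)
    ((measurable_empMean_deviation J θ).prodMap (measurable_empMean_deviation J θ'))]
  congr 1
  ext1 w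
  have hs : √((n : ℝ) / 2) = (√2)⁻¹ * √n := by
    rw [Real.sqrt_div n.cast_nonneg, inv_mul_eq_div]
  simp only [Function.comp, Prod.map, diffNoise, sumNoise, hs, mul_smul, ← smul_sub, ← smul_add,
    sub_sub_sub_comm, add_sub_add_comm]

/-! ### Gaussian moments and tails -/

lemma integrable_exp_sq_div_four : Integrable (fun x => Real.exp (x ^ 2 / 4)) (gaussianReal 0 1) ∧
    ∫ x, Real.exp (x ^ 2 / 4) ∂(gaussianReal 0 1) = √2 := by
  have e : ∀ x : ℝ, gaussianPDFReal 0 1 x * Real.exp (x ^ 2 / 4) =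
      (√(2 * Real.pi))⁻¹ * Real.exp (-(1 / 4) * x ^ 2) := by
    intro x
    simp only [gaussianPDFReal, sub_zero, NNReal.coe_one, mul_one]
    rw [mul_assoc, ← Real.exp_add]; congr 2; ring
  constructor
  · rw [gaussianReal_of_var_ne_zero _ one_ne_zero,
      integrable_withDensity_iff_integrable_smul' (measurable_gaussianPDF 0 1)
        (ae_of_all _ fun _ => gaussianPDF_lt_top)]
    simp only [toReal_gaussianPDF, smul_eq_mul, e]
    exact (integrable_exp_neg_mul_sq (by norm_num)).const_mul _
  · rw [integral_gaussianReal_eq_integral_smul one_ne_zero]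
    simp only [smul_eq_mul, e]
    rw [integral_const_mul, integral_gaussian, ← Real.sqrt_inv, ← Real.sqrt_mul (by positivity)]
    congr 1
    have := Real.pi_pos
    field_simp
    norm_num

lemma sqrt_two_le_two : √2 ≤ (2 : ℝ) := by
  rw [Real.sqrt_le_left (by norm_num)]; norm_num

lemma lintegral_exp_sq_le {b : ℝ} (hb : b ≤ 1 / 4) :
    ∫⁻ x, ENNReal.ofReal (Real.exp (b * x ^ 2)) ∂(gaussianReal 0 1) ≤ 2 := by
  calc ∫⁻ x, ENNReal.ofReal (Real.exp (b * x ^ 2)) ∂(gaussianReal 0 1)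
      ≤ ∫⁻ x, ENNReal.ofReal (Real.exp (x ^ 2 / 4)) ∂(gaussianReal 0 1) := by
        refine lintegral_mono fun x => ENNReal.ofReal_le_ofReal (Real.exp_le_exp.2 ?_)
        nlinarith [mul_nonneg (sub_nonneg.2 hb) (sq_nonneg x)]
    _ = ENNReal.ofReal √2 := by
        rw [← integrable_exp_sq_div_four.2, ofReal_integral_eq_lintegral_ofReal
          integrable_exp_sq_div_four.1 (ae_of_all _ fun _ => (Real.exp_pos _).le)]
    _ ≤ 2 := ENNReal.ofReal_le_of_le_toReal sqrt_two_le_two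

lemma gaussianReal_abs_ge_le {t : ℝ} (ht : 0 ≤ t) :
    (gaussianReal 0 1).real {x | t ≤ |x|} ≤ 2 * Real.exp (-t ^ 2 / 4) := by
  have h := mul_meas_ge_le_integral_of_nonneg (μ := gaussianReal 0 1)
    (ae_of_all _ fun x => (Real.exp_pos (x ^ 2 / 4)).le) integrable_exp_sq_div_four.1
    (Real.exp (t ^ 2 / 4))
  rw [integrable_exp_sq_div_four.2] at h
  have hsub : {x : ℝ | t ≤ |x|} ⊆ {x | Real.exp (t ^ 2 / 4) ≤ Real.exp (x ^ 2 / 4)} := by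
    intro x hx
    have : t ^ 2 ≤ x ^ 2 := by rw [← sq_abs x]; exact pow_le_pow_left₀ ht hx 2
    exact Real.exp_le_exp.2 (by linarith)
  calc (gaussianReal 0 1).real {x | t ≤ |x|}
      ≤ (gaussianReal 0 1).real {x | Real.exp (t ^ 2 / 4) ≤ Real.exp (x ^ 2 / 4)} :=
        measureReal_mono hsub
    _ = Real.exp (-t ^ 2 / 4) * (Real.exp (t ^ 2 / 4) *
        (gaussianReal 0 1).real {x | Real.exp (t ^ 2 / 4) ≤ Real.exp (x ^ 2 / 4)}) := by
        rw [← mul_assoc, ← Real.exp_add, show -t ^ 2 / 4 + t ^ 2 / 4 = 0 by ring, Real.exp_zero,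
          one_mul]
    _ ≤ Real.exp (-t ^ 2 / 4) * 2 := by
        gcongr
        exact h.trans sqrt_two_le_two
    _ = _ := mul_comm _ _

lemma lintegral_sq_gaussianReal :
    ∫⁻ x, ENNReal.ofReal (x ^ 2) ∂(gaussianReal 0 1) = 1 := by
  have h := variance_fun_id_gaussianReal (μ := 0) (v := 1)
  rw [variance_eq_integral (by fun_prop)] at h
  simp only [integral_id_gaussianReal, sub_zero, NNReal.coe_one] at h
  have hi : Integrable (fun x : ℝ => x ^ 2) (gaussianReal 0 1) :=
    (memLp_id_gaussianReal' 2 (by norm_num)).integrable_sq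
  rw [← ofReal_integral_eq_lintegral_ofReal hi (ae_of_all _ fun x => sq_nonneg x), h,
    ENNReal.ofReal_one]

lemma map_coord_stdGaussian {J : ℕ} (j : Fin J) :
    (stdGaussian (EuclideanSpace ℝ (Fin J))).map (fun x => x j) = gaussianReal 0 1 := by
  rw [← map_inner_stdGaussian (e := EuclideanSpace.single j (1 : ℝ)) (by simp)]
  congr 1; ext x
  simp [EuclideanSpace.inner_single_left]

/-- `E ‖ξ‖ ≤ √J` for a standard Gaussian vector. -/
lemma lintegral_norm_stdGaussian_le (J : ℕ) :
    ∫⁻ x, ENNReal.ofReal ‖x‖ ∂(stdGaussian (EuclideanSpace ℝ (Fin J))) ≤ ENNReal.ofReal √J := by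
  rcases Nat.eq_zero_or_pos J with rfl | hJ
  · have : ∀ x : EuclideanSpace ℝ (Fin 0), ‖x‖ = 0 := fun x => by
      rw [Subsingleton.elim x 0, norm_zero]
    simp [this]
  have hJ0 : 0 < √(J : ℝ) := Real.sqrt_pos.2 (Nat.cast_pos.2 hJ)
  have hJ2 : √(J : ℝ) ^ 2 = J := Real.sq_sqrt (Nat.cast_nonneg _)
  have hsq : ∫⁻ x, ENNReal.ofReal (‖x‖ ^ 2) ∂(stdGaussian (EuclideanSpace ℝ (Fin J))) = J := by
    have e : ∀ x : EuclideanSpace ℝ (Fin J),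
        ENNReal.ofReal (‖x‖ ^ 2) = ∑ j, ENNReal.ofReal (x j ^ 2) := by
      intro x
      rw [EuclideanSpace.norm_sq_eq, ENNReal.ofReal_sum_of_nonneg fun _ _ => sq_nonneg _]
      simp
    simp_rw [e]
    rw [lintegral_finsetSum _ fun j _ => by fun_prop]
    have : ∀ j : Fin J, ∫⁻ x, ENNReal.ofReal (x j ^ 2)
        ∂(stdGaussian (EuclideanSpace ℝ (Fin J))) = 1 := by
      intro j
      rw [← lintegral_sq_gaussianReal, ← map_coord_stdGaussian j,
        lintegral_map (by fun_prop) (by fun_prop)]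
    simp [this]
  calc ∫⁻ x, ENNReal.ofReal ‖x‖ ∂(stdGaussian (EuclideanSpace ℝ (Fin J)))
      ≤ ∫⁻ x, (ENNReal.ofReal (2 * √J)⁻¹ * ENNReal.ofReal (‖x‖ ^ 2) + ENNReal.ofReal (√J / 2))
          ∂(stdGaussian (EuclideanSpace ℝ (Fin J))) := by
        refine lintegral_mono fun x => ?_
        rw [← ENNReal.ofReal_mul (by positivity), ← ENNReal.ofReal_add (by positivity)
          (by positivity)]
        refine ENNReal.ofReal_le_ofReal ?_
        have h := sq_nonneg (‖x‖ - √J)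
        rw [inv_mul_eq_div, div_add_div _ _ (by positivity) (by norm_num), le_div_iff₀
          (by positivity)]
        nlinarith
    _ = ENNReal.ofReal √J := by
        rw [lintegral_add_right _ measurable_const, lintegral_const_mul _ (by fun_prop), hsq,
          lintegral_const, measure_univ, mul_one, ← ENNReal.ofReal_natCast J,
          ← ENNReal.ofReal_mul (by positivity), ← ENNReal.ofReal_add (by positivity)
          (by positivity)]
        congr 1
        field_simp; rw [hJ2]; ring

/-- Chernoff bound for the norm of a standard Gaussian vector. -/
lemma stdGaussian_norm_ge_le (J : ℕ) {t : ℝ} (ht : 0 ≤ t) :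
    (stdGaussian (EuclideanSpace ℝ (Fin J))).real {x | 2 * (√J + t) ≤ ‖x‖} ≤
      Real.exp (-t ^ 2) := by
  let f : EuclideanSpace ℝ (Fin J) → ℝ := fun x => ∏ j, Real.exp (x j ^ 2 / 4)
  have hf : ∀ x, f x = Real.exp (‖x‖ ^ 2 / 4) := fun x => by
    simp only [f]
    rw [← Real.exp_sum, EuclideanSpace.norm_sq_eq, Finset.sum_div]
    simp
  have hi : Integrable f (stdGaussian (EuclideanSpace ℝ (Fin J))) := by
    rw [← map_pi_eq_stdGaussian, integrable_map_measure (by fun_prop) (by fun_prop)]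
    exact Integrable.fintype_prod (f := fun (_ : Fin J) x => Real.exp (x ^ 2 / 4))
      fun _ => integrable_exp_sq_div_four.1
  have hint : ∫ x, f x ∂(stdGaussian (EuclideanSpace ℝ (Fin J))) = √2 ^ J := by
    rw [← map_pi_eq_stdGaussian, integral_map (by fun_prop) (by fun_prop)]
    refine (integral_fintype_prod_eq_pow (ι := Fin J)
      (f := fun x : ℝ => Real.exp (x ^ 2 / 4))).trans ?_
    rw [integrable_exp_sq_div_four.2, Fintype.card_fin]
  have h := mul_meas_ge_le_integral_of_nonneg (μ := stdGaussian (EuclideanSpace ℝ (Fin J)))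
    (ae_of_all _ fun x => by rw [hf]; exact (Real.exp_pos _).le) hi (Real.exp (J + t ^ 2))
  rw [hint] at h
  have h2 : √2 ^ J ≤ Real.exp J := by
    rw [← Real.exp_one_pow J]
    gcongr
    exact sqrt_two_le_two.trans (by linarith [Real.add_one_le_exp 1])
  have hsub : {x : EuclideanSpace ℝ (Fin J) | 2 * (√J + t) ≤ ‖x‖} ⊆
      {x | Real.exp (J + t ^ 2) ≤ f x} := by
    intro x hx
    simp only [Set.mem_ofPred_eq] at hx ⊢
    rw [hf, Real.exp_le_exp]
    have h0 : 0 ≤ √(J : ℝ) := Real.sqrt_nonneg _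
    have hJ2 : √(J : ℝ) ^ 2 = J := Real.sq_sqrt (Nat.cast_nonneg _)
    have : (2 * (√J + t)) ^ 2 ≤ ‖x‖ ^ 2 := pow_le_pow_left₀ (by positivity) hx 2
    nlinarith [mul_nonneg h0 ht]
  refine (measureReal_mono hsub).trans ?_
  have h3 : Real.exp J * (Real.exp (t ^ 2) * (stdGaussian (EuclideanSpace ℝ (Fin J))).real
      {x | Real.exp (J + t ^ 2) ≤ f x}) ≤ Real.exp J * 1 := by
    rw [← mul_assoc, ← Real.exp_add, mul_one]; exact h.trans h2
  have h4 := le_of_mul_le_mul_left h3 (Real.exp_pos _)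
  rw [Real.exp_neg, ← one_div, le_div_iff₀ (Real.exp_pos _), mul_comm]
  exact h4

lemma gaussianReal_real_Iio_zero : (gaussianReal 0 1).real (Set.Iio 0) ≤ 1 / 2 := by
  have h1 : (gaussianReal 0 1).real (Set.Ioi 0) = (gaussianReal 0 1).real (Set.Iio 0) := by
    have h := gaussianReal_map_neg (μ := 0) (v := 1)
    rw [neg_zero] at h
    conv_lhs => rw [← h]
    rw [map_measureReal_apply (by fun_prop) measurableSet_Ioi]
    congr 1; ext x; simp
  have h2 : (gaussianReal 0 1).real (Set.Iio 0 ∪ Set.Ioi 0) ≤ 1 := measureReal_le_one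
  have hdisj : Disjoint (Set.Iio (0 : ℝ)) (Set.Ioi 0) :=
    Set.disjoint_left.2 fun x (hx : x < 0) (hx' : 0 < x) => (hx.trans hx').false
  rw [measureReal_union hdisj measurableSet_Ioi,
    h1] at h2
  linarith

/-- Near the median the Gaussian distribution function grows linearly. -/
lemma gaussianReal_real_Iio_neg_le {a R : ℝ} (ha : 0 ≤ a) (haR : a ≤ R) :
    (gaussianReal 0 1).real (Set.Iio (-a)) ≤ 1 / 2 - a * gaussianPDFReal 0 1 R := by
  have h := mul_pdf_le_gaussianReal_Ico (a := -a) (b := 0) (R := R) (by linarith) (by linarith)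
    (by linarith)
  have hu : Set.Iio (-a) ∪ Set.Ico (-a) 0 = Set.Iio (0 : ℝ) := by
    ext x; simp only [Set.mem_union, Set.mem_Iio, Set.mem_Ico]
    constructor
    · rintro (h | h) <;> linarith [h]
    · intro h
      rcases lt_or_ge x (-a) with h' | h'
      · exact Or.inl h'
      · exact Or.inr ⟨h', h⟩
  have h2 := gaussianReal_real_Iio_zero
  have hdisj : Disjoint (Set.Iio (-a)) (Set.Ico (-a) 0) :=
    Set.disjoint_left.2 fun x hx hx' => absurd hx'.1 (not_le.2 hx)
  rw [← hu, measureReal_union hdisj measurableSet_Ico] at h2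
  linarith

/-! ### Decoupling the noise -/

section Decoupling

variable {E : Type*} [NormedAddCommGroup E] [InnerProductSpace ℝ E] [FiniteDimensional ℝ E]
  [MeasurableSpace E] [BorelSpace E]

/-- Projecting a Gaussian vector on a unit direction chosen from an independent vector gives a
standard Gaussian variable, independent of the latter. -/
lemma map_inner_random_direction {u : E → E} (hu : Measurable u) (hu1 : ∀ x, ‖u x‖ = 1) :
    ((stdGaussian E).prod (stdGaussian E)).map (fun p => (p.1, ⟪u p.1, p.2⟫)) =
      (stdGaussian E).prod (gaussianReal 0 1) := by
  have hm : Measurable fun p : E × E => (p.1, ⟪u p.1, p.2⟫) :=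
    measurable_fst.prodMk ((hu.comp measurable_fst).inner measurable_snd)
  refine (Measure.prod_eq fun s t hs ht => ?_).symm
  rw [Measure.map_apply hm (hs.prod ht), Measure.prod_apply (hm (hs.prod ht))]
  have e : ∀ x, (stdGaussian E) (Prod.mk x ⁻¹' ((fun p : E × E => (p.1, ⟪u p.1, p.2⟫)) ⁻¹' s ×ˢ t))
      = s.indicator (fun _ => gaussianReal 0 1 t) x := by
    intro x
    by_cases hx : x ∈ s
    · rw [Set.indicator_of_mem hx, ← map_inner_stdGaussian (hu1 x),
        Measure.map_apply (by fun_prop) ht]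
      congr 1; ext y; simp [hx]
    · rw [Set.indicator_of_notMem hx]
      convert measure_empty (μ := stdGaussian E)
      ext y; simp [hx]
  simp_rw [e]
  rw [lintegral_indicator_const hs, mul_comm]

/-- The component of a standard Gaussian vector along a unit vector is independent of the
orthogonal component. -/
lemma map_inner_orthogonal_stdGaussian {e : E} (he : ‖e‖ = 1) :
    (stdGaussian E).map (fun x => (⟪e, x⟫, x - ⟪e, x⟫ • e)) =
      (gaussianReal 0 1).prod ((stdGaussian E).map fun x => x - ⟪e, x⟫ • e) := by
  let L : E →L[ℝ] ℝ × E :=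
    (innerSL ℝ e).prod (ContinuousLinearMap.id ℝ E - (innerSL ℝ e).smulRight e)
  have hG : HasGaussianLaw (fun x : E => (⟪e, x⟫, x - ⟪e, x⟫ • e)) (stdGaussian E) := by
    have := (IsGaussian.hasGaussianLaw_id (μ := stdGaussian E)).map L
    exact this
  have hI : IndepFun (fun x : E => ⟪e, x⟫) (fun x => x - ⟪e, x⟫ • e) (stdGaussian E) := by
    refine hG.indepFun_of_covariance_inner fun a y => ?_
    have h1 : (fun x : E => ⟪a, ⟪e, x⟫⟫) = fun x => ⟪a • e, x⟫ := by
      ext x; simp [inner_smul_left, mul_comm]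
    have h2 : (fun x : E => ⟪y, x - ⟪e, x⟫ • e⟫) = fun x => ⟪y - ⟪e, y⟫ • e, x⟫ := by
      ext x
      simp only [inner_sub_right, inner_sub_left, inner_smul_left, inner_smul_right,
        RCLike.conj_to_real, real_inner_comm e y]
      ring
    rw [h1, h2, ← covarianceBilin_apply_eq_cov IsGaussian.memLp_two_id,
      covarianceBilin_stdGaussian, innerSL_apply_apply, inner_smul_left, inner_sub_right,
      inner_smul_right, real_inner_self_eq_norm_sq, he]
    simp
  rw [(indepFun_iff_map_prod_eq_prod_map_map (by fun_prop) (by fun_prop)).1 hI,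
    map_inner_stdGaussian he]

/-- The component of the first vector along `e` is independent of its orthogonal component and of
the projection of the second vector on a direction depending on the first one only. -/
lemma map_decoupling {e : E} (he : ‖e‖ = 1) {u : E → E} (hu : Measurable u)
    (hu1 : ∀ x, ‖u x‖ = 1) :
    ((stdGaussian E).prod (stdGaussian E)).map
      (fun p => (⟪e, p.1⟫, (p.1 - ⟪e, p.1⟫ • e, ⟪u p.1, p.2⟫))) =
      (gaussianReal 0 1).prod
        (((stdGaussian E).map fun x => x - ⟪e, x⟫ • e).prod (gaussianReal 0 1)) := by
  have hm : Measurable fun p : E × E => (p.1, ⟪u p.1, p.2⟫) :=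
    measurable_fst.prodMk ((hu.comp measurable_fst).inner measurable_snd)
  have hg : Measurable fun x : E => (⟪e, x⟫, x - ⟪e, x⟫ • e) := by fun_prop
  have hW : IsProbabilityMeasure ((stdGaussian E).map fun x => x - ⟪e, x⟫ • e) :=
    Measure.isProbabilityMeasure_map (by fun_prop)
  rw [← Measure.prodAssoc_prod, ← map_inner_orthogonal_stdGaussian he]
  conv_rhs => rw [← Measure.map_id (μ := gaussianReal 0 1)]
  rw [Measure.map_prod_map _ _ hg measurable_id, ← map_inner_random_direction hu hu1,
    Measure.map_map (hg.prodMap measurable_id) hm, Measure.map_map (by fun_prop)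
      ((hg.prodMap measurable_id).comp hm)]
  rfl

end Decoupling

lemma gaussianReal_Icc_le {a b : ℝ} (hab : a ≤ b) :
    (gaussianReal 0 1).real (Set.Icc a b) ≤ b - a := by
  have := nullSingletonClass_gaussianReal (μ := 0) (v := 1) one_ne_zero
  rw [← measureReal_congr (Ico_ae_eq_Icc (a := a) (b := b))]
  exact gaussianReal_Ico_le hab

/-- The distribution function of a standard Gaussian variable is Lipschitz, hence stable under an
independent random perturbation of its argument. -/
lemma gaussianReal_prod_le {Ω : Type*} [MeasurableSpace Ω] (κ : Measure Ω) [IsProbabilityMeasure κ]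
    {U : Ω → ℝ} (hU : Measurable U) (hU0 : ∀ x, 0 ≤ U x) {a : ℝ} :
    ((gaussianReal 0 1).prod κ) {p | p.1 ≤ -a + U p.2} ≤
      gaussianReal 0 1 (Set.Iio (-a)) + ∫⁻ x, ENNReal.ofReal (U x) ∂κ := by
  have hS : MeasurableSet {p : ℝ × Ω | p.1 ≤ -a + U p.2} :=
    measurableSet_le measurable_fst (measurable_const.add (hU.comp measurable_snd))
  rw [Measure.prod_apply_symm hS]
  calc ∫⁻ x, gaussianReal 0 1 ((fun y => (y, x)) ⁻¹' {p : ℝ × Ω | p.1 ≤ -a + U p.2}) ∂κ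
      ≤ ∫⁻ x, (gaussianReal 0 1 (Set.Iio (-a)) + ENNReal.ofReal (U x)) ∂κ := by
        refine lintegral_mono fun x => ?_
        have hsub : ((fun y => (y, x)) ⁻¹' {p : ℝ × Ω | p.1 ≤ -a + U p.2}) ⊆
            Set.Iio (-a) ∪ Set.Icc (-a) (-a + U x) := by
          intro y hy
          rcases lt_or_ge y (-a) with h | h
          · exact Or.inl h
          · exact Or.inr ⟨h, hy⟩
        refine (measure_mono hsub).trans ((measure_union_le _ _).trans ?_)
        gcongr
        have := gaussianReal_Icc_le (a := -a) (b := -a + U x) (by linarith [hU0 x])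
        rw [← ofReal_measureReal]
        exact ENNReal.ofReal_le_ofReal (by linarith)
    _ = _ := by
        rw [lintegral_add_left measurable_const, lintegral_const, measure_univ, mul_one]

/-! ### Probability that the estimated direction separates -/

section GoodNoise

variable {E : Type*} [NormedAddCommGroup E] [InnerProductSpace ℝ E]

/-- The unit vector in the direction of `D`, with the default value `e` when `D = 0`. -/
noncomputable def unitDir (e D : E) : E :=
  open Classical in if D = 0 then e else ‖D‖⁻¹ • D

lemma norm_unitDir {e : E} (he : ‖e‖ = 1) (D : E) : ‖unitDir e D‖ = 1 := by
  unfold unitDir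
  split_ifs with h
  · exact he
  · rw [norm_smul, norm_inv, norm_norm, inv_mul_cancel₀ (norm_ne_zero_iff.2 h)]

lemma measurable_unitDir [MeasurableSpace E] [BorelSpace E] [FiniteDimensional ℝ E] (e : E) :
    Measurable (unitDir e) := by
  classical
  refine Measurable.ite (measurableSet_singleton (0 : E)) measurable_const ?_
  fun_prop

/-- The noise configurations `(ξ, ζ)` for which the direction `D = Δ + σ ξ` has projection on `Δ`
at least `q exp (m²) ‖D‖`, where `m` is the offset, caused by `ζ`, of the threshold in the
direction `D`. -/
def goodNoise (Δ : E) (σ q : ℝ) : Set (E × E) :=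
  {p | Δ + σ • p.1 ≠ 0 ∧
    q * Real.exp ((σ / 2 * (⟪Δ + σ • p.1, p.2⟫ / ‖Δ + σ • p.1‖)) ^ 2) * ‖Δ + σ • p.1‖ ≤
      ⟪Δ + σ • p.1, Δ⟫}

/-- If the component `g` of the noise along `Δ` is not too negative compared with the orthogonal
component `W`, then the projection of `D = Δ + σ ξ` on `Δ` is at least `v ‖D‖`. -/
lemma direction_of_noise {Δ ξ : E} {σ v : ℝ} (hΔ : Δ ≠ 0) (hσ : 0 < σ) (hv : 0 < v)
    (hv2 : v ≤ ‖Δ‖ / 2)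
    (hg : -(‖Δ‖ / σ) + 2 * v * ‖ξ - ⟪‖Δ‖⁻¹ • Δ, ξ⟫ • ‖Δ‖⁻¹ • Δ‖ / ‖Δ‖ < ⟪‖Δ‖⁻¹ • Δ, ξ⟫) :
    Δ + σ • ξ ≠ 0 ∧ v * ‖Δ + σ • ξ‖ ≤ ⟪Δ + σ • ξ, Δ⟫ := by
  have hd : 0 < ‖Δ‖ := norm_pos_iff.2 hΔ
  set d := ‖Δ‖ with hdd
  set e := d⁻¹ • Δ with he
  have he1 : ‖e‖ = 1 := by rw [he, norm_smul, norm_inv, ← hdd, Real.norm_eq_abs, abs_of_pos hd,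
    inv_mul_cancel₀ hd.ne']
  have hΔe : Δ = d • e := by rw [he, smul_smul, mul_inv_cancel₀ hd.ne', one_smul]
  clear_value e
  set g := ⟪e, ξ⟫ with hgdef
  set W := ξ - g • e with hW
  have hin : ⟪Δ + σ • ξ, Δ⟫ = d * (d + σ * g) := by
    rw [inner_add_left, real_inner_self_eq_norm_sq, ← hdd, inner_smul_left, real_inner_comm,
      hΔe, inner_smul_left, ← hgdef]
    simp only [RCLike.conj_to_real]; ring
  have hD : Δ + σ • ξ = (d + σ * g) • e + σ • W := by
    rw [hW, add_smul, ← hΔe, smul_sub, smul_smul]; abel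
  have hlow : 2 * v * σ * ‖W‖ / d < d + σ * g := by
    have := mul_lt_mul_of_pos_left hg hσ
    have e1 : σ * (-(d / σ) + 2 * v * ‖W‖ / d) = -d + 2 * v * σ * ‖W‖ / d := by
      field_simp
    rw [e1] at this; linarith
  have hpos : 0 < d + σ * g := lt_of_le_of_lt (by positivity) hlow
  have hlow' : 2 * v * σ * ‖W‖ ≤ d * (d + σ * g) := by
    rw [div_lt_iff₀ hd] at hlow; linarith
  rw [hin]
  refine ⟨fun h => ?_, ?_⟩
  · rw [h, inner_zero_left] at hin
    exact (mul_pos hd hpos).ne hin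
  · have hn : ‖Δ + σ • ξ‖ ≤ (d + σ * g) + σ * ‖W‖ := by
      rw [hD]
      refine (norm_add_le _ _).trans (le_of_eq ?_)
      rw [norm_smul, norm_smul, he1, Real.norm_eq_abs, Real.norm_eq_abs, abs_of_pos hpos,
        abs_of_pos hσ, mul_one]
    calc v * ‖Δ + σ • ξ‖ ≤ v * ((d + σ * g) + σ * ‖W‖) := by gcongr
      _ = v * (d + σ * g) + (2 * v * σ * ‖W‖) / 2 := by ring
      _ ≤ d / 2 * (d + σ * g) + d * (d + σ * g) / 2 := by gcongr
      _ = _ := by ring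

/-- A bad noise configuration has a large threshold offset or a very negative component along
`Δ`. -/
lemma compl_goodNoise_subset {Δ : E} {σ q : ℝ} (hΔ : Δ ≠ 0) (hσ : 0 < σ) (hq : 0 < q) :
    (goodNoise Δ σ q)ᶜ ⊆
      (fun p : E × E => (⟪‖Δ‖⁻¹ • Δ, p.1⟫, (p.1 - ⟪‖Δ‖⁻¹ • Δ, p.1⟫ • ‖Δ‖⁻¹ • Δ,
        ⟪unitDir (‖Δ‖⁻¹ • Δ) (Δ + σ • p.1), p.2⟫))) ⁻¹'
      ({x | ‖Δ‖ / 2 < q * Real.exp ((σ / 2 * x.2.2) ^ 2)} ∪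
       {x | x.1 ≤ -(‖Δ‖ / σ) +
          2 * (q * Real.exp ((σ / 2 * x.2.2) ^ 2)) * ‖x.2.1‖ / ‖Δ‖}) := by
  intro p hp
  by_contra hcon
  apply hp
  simp only [Set.mem_preimage, Set.mem_union, Set.mem_ofPred_eq, not_or, not_lt, not_le] at hcon
  obtain ⟨h1, h2⟩ := hcon
  have h := direction_of_noise hΔ hσ (by positivity) h1 h2
  have hu : ⟪unitDir (‖Δ‖⁻¹ • Δ) (Δ + σ • p.1), p.2⟫ = ⟪Δ + σ • p.1, p.2⟫ / ‖Δ + σ • p.1‖ := by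
    rw [unitDir, if_neg h.1, inner_smul_left, RCLike.conj_to_real, inv_mul_eq_div]
  rw [hu] at h
  exact h

variable [MeasurableSpace E] [BorelSpace E] [FiniteDimensional ℝ E]

lemma measurableSet_goodNoise (Δ : E) (σ q : ℝ) : MeasurableSet (goodNoise Δ σ q) := by
  have h1 : MeasurableSet {p : E × E | Δ + σ • p.1 = 0} :=
    measurableSet_eq_fun (by fun_prop) measurable_const
  have h2 : MeasurableSet {p : E × E |
      q * Real.exp ((σ / 2 * (⟪Δ + σ • p.1, p.2⟫ / ‖Δ + σ • p.1‖)) ^ 2) * ‖Δ + σ • p.1‖ ≤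
        ⟪Δ + σ • p.1, Δ⟫} := measurableSet_le (by fun_prop) (by fun_prop)
  exact h1.compl.inter h2

end GoodNoise

section Bounds

variable {J : ℕ}

lemma measurable_decoupled {Δ : EuclideanSpace ℝ (Fin J)} {σ : ℝ} :
    Measurable fun p : EuclideanSpace ℝ (Fin J) × EuclideanSpace ℝ (Fin J) =>
      (⟪‖Δ‖⁻¹ • Δ, p.1⟫, (p.1 - ⟪‖Δ‖⁻¹ • Δ, p.1⟫ • ‖Δ‖⁻¹ • Δ,
        ⟪unitDir (‖Δ‖⁻¹ • Δ) (Δ + σ • p.1), p.2⟫)) := by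
  have := measurable_unitDir (‖Δ‖⁻¹ • Δ)
  fun_prop

lemma norm_orthogonal_le {E : Type*} [NormedAddCommGroup E] [InnerProductSpace ℝ E] {e : E}
    (he : ‖e‖ = 1) (x : E) : ‖x - ⟪e, x⟫ • e‖ ≤ ‖x‖ := by
  have h : ‖x - ⟪e, x⟫ • e‖ ^ 2 = ‖x‖ ^ 2 - ⟪e, x⟫ ^ 2 := by
    rw [norm_sub_sq_real, inner_smul_right, norm_smul, he, mul_one, Real.norm_eq_abs, sq_abs,
      real_inner_comm]
    ring
  exact le_of_sq_le_sq (by nlinarith [sq_nonneg ⟪e, x⟫]) (norm_nonneg _)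

lemma norm_normalize {E : Type*} [NormedAddCommGroup E] [InnerProductSpace ℝ E] {Δ : E}
    (hΔ : Δ ≠ 0) : ‖‖Δ‖⁻¹ • Δ‖ = 1 := by
  rw [norm_smul, norm_inv, norm_norm, inv_mul_cancel₀ (norm_ne_zero_iff.2 hΔ)]

/-- Sharp bound on the failure probability, useful when the signal-to-noise ratio `‖Δ‖ / σ` is
bounded: it exceeds the probability that the component along `Δ` points the wrong way only by a
term linear in `q`. The threshold offset is controlled by Markov's inequality, the orthogonal
component through its mean. -/
lemma compl_goodNoise_le_of_small {Δ : EuclideanSpace ℝ (Fin J)} {σ q : ℝ} (hΔ : Δ ≠ 0)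
    (hσ : 0 < σ) (hσ1 : σ ≤ 1) (hq : 0 < q) :
    ((stdGaussian (EuclideanSpace ℝ (Fin J))).prod (stdGaussian _)).real (goodNoise Δ σ q)ᶜ ≤
      (gaussianReal 0 1).real (Set.Iio (-(‖Δ‖ / σ))) + 4 * q / ‖Δ‖ + 4 * q * √J / ‖Δ‖ := by
  have hd : 0 < ‖Δ‖ := norm_pos_iff.2 hΔ
  have he := norm_normalize hΔ
  set e := ‖Δ‖⁻¹ • Δ with hedef
  set γ := gaussianReal 0 1 with hγ
  set ν := (stdGaussian (EuclideanSpace ℝ (Fin J))).map fun x => x - ⟪e, x⟫ • e with hν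
  have hνp : IsProbabilityMeasure ν := Measure.isProbabilityMeasure_map (by fun_prop)
  have hexp : ∫⁻ y, ENNReal.ofReal (Real.exp ((σ / 2 * y) ^ 2)) ∂γ ≤ 2 := by
    have := lintegral_exp_sq_le (b := (σ / 2) ^ 2) (by nlinarith)
    simpa only [mul_pow] using this
  have hnorm : ∫⁻ x, ENNReal.ofReal ‖x‖ ∂ν ≤ ENNReal.ofReal √J := by
    rw [hν, lintegral_map (by fun_prop) (by fun_prop)]
    exact (lintegral_mono fun x => ENNReal.ofReal_le_ofReal (norm_orthogonal_le he x)).trans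
      (lintegral_norm_stdGaussian_le J)
  let A : Set (ℝ × (EuclideanSpace ℝ (Fin J) × ℝ)) :=
    {x | ‖Δ‖ / 2 < q * Real.exp ((σ / 2 * x.2.2) ^ 2)}
  let U : EuclideanSpace ℝ (Fin J) × ℝ → ℝ := fun x =>
    2 * (q * Real.exp ((σ / 2 * x.2) ^ 2)) * ‖x.1‖ / ‖Δ‖
  have hA : (γ.prod (ν.prod γ)) A ≤ ENNReal.ofReal (4 * q / ‖Δ‖) := by
    let f : ℝ → ℝ≥0∞ := fun y => ENNReal.ofReal (Real.exp ((σ / 2 * y) ^ 2))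
    have hfm : Measurable f := by fun_prop
    have hsub : A ⊆ (fun x : ℝ × (EuclideanSpace ℝ (Fin J) × ℝ) => x.2.2) ⁻¹'
        {y | ENNReal.ofReal (‖Δ‖ / (2 * q)) ≤ f y} := by
      intro x hx
      refine ENNReal.ofReal_le_ofReal ?_
      have : ‖Δ‖ / 2 < q * Real.exp ((σ / 2 * x.2.2) ^ 2) := hx
      rw [div_le_iff₀ (by positivity)]; linarith
    have hmp : MeasurePreserving (fun x : ℝ × (EuclideanSpace ℝ (Fin J) × ℝ) => x.2.2)
        (γ.prod (ν.prod γ)) γ := measurePreserving_snd.comp measurePreserving_snd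
    refine (measure_mono hsub).trans ?_
    rw [hmp.measure_preimage (measurableSet_le measurable_const hfm).nullMeasurableSet]
    refine (meas_ge_le_lintegral_div hfm.aemeasurable (by simpa using by positivity)
      ENNReal.ofReal_ne_top).trans ?_
    calc (∫⁻ y, f y ∂γ) / ENNReal.ofReal (‖Δ‖ / (2 * q))
        ≤ ENNReal.ofReal 2 / ENNReal.ofReal (‖Δ‖ / (2 * q)) := by
          gcongr; simpa using hexp
      _ = ENNReal.ofReal (4 * q / ‖Δ‖) := by
          rw [← ENNReal.ofReal_div_of_pos (by positivity)]
          congr 1; field_simp; norm_num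
  have hUm : Measurable U := by fun_prop
  have hU : ∫⁻ x, ENNReal.ofReal (U x) ∂(ν.prod γ) ≤ ENNReal.ofReal (4 * q * √J / ‖Δ‖) := by
    have e1 : ∀ x : EuclideanSpace ℝ (Fin J) × ℝ, ENNReal.ofReal (U x) =
        ENNReal.ofReal (2 * q / ‖Δ‖) * (ENNReal.ofReal ‖x.1‖ *
          ENNReal.ofReal (Real.exp ((σ / 2 * x.2) ^ 2))) := by
      intro x
      rw [← ENNReal.ofReal_mul (norm_nonneg _), ← ENNReal.ofReal_mul (by positivity)]
      congr 1; simp only [U]; ring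
    simp_rw [e1]
    rw [lintegral_const_mul _ (by fun_prop),
      lintegral_prod_mul (f := fun x => ENNReal.ofReal ‖x‖)
        (g := fun y => ENNReal.ofReal (Real.exp ((σ / 2 * y) ^ 2))) (by fun_prop) (by fun_prop)]
    calc ENNReal.ofReal (2 * q / ‖Δ‖) * ((∫⁻ x, ENNReal.ofReal ‖x‖ ∂ν) *
          ∫⁻ y, ENNReal.ofReal (Real.exp ((σ / 2 * y) ^ 2)) ∂γ)
        ≤ ENNReal.ofReal (2 * q / ‖Δ‖) * (ENNReal.ofReal √J * ENNReal.ofReal 2) := by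
          gcongr; simpa using hexp
      _ = ENNReal.ofReal (4 * q * √J / ‖Δ‖) := by
          rw [← ENNReal.ofReal_mul (by positivity), ← ENNReal.ofReal_mul (by positivity)]
          congr 1; ring
  have hB := gaussianReal_prod_le (ν.prod γ) hUm (fun x => by positivity) (a := ‖Δ‖ / σ)
  have hmeas : MeasurableSet (A ∪ {x | x.1 ≤ -(‖Δ‖ / σ) + U x.2}) := by
    refine MeasurableSet.union ?_ ?_
    · exact measurableSet_lt measurable_const (by fun_prop)
    · exact measurableSet_le (by fun_prop) (by fun_prop)
  have hlaw := map_decoupling he (u := fun x => unitDir e (Δ + σ • x))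
    ((measurable_unitDir e).comp (by fun_prop)) fun x => norm_unitDir he _
  have htot : ((stdGaussian (EuclideanSpace ℝ (Fin J))).prod (stdGaussian _)) (goodNoise Δ σ q)ᶜ ≤
      ENNReal.ofReal (γ.real (Set.Iio (-(‖Δ‖ / σ))) + 4 * q / ‖Δ‖ + 4 * q * √J / ‖Δ‖) := by
    refine (measure_mono (compl_goodNoise_subset hΔ hσ hq)).trans ?_
    rw [← Measure.map_apply measurable_decoupled hmeas, hlaw]
    refine (measure_union_le _ _).trans ?_
    refine (add_le_add hA (hB.trans (add_le_add_right hU _))).trans (le_of_eq ?_)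
    rw [← ofReal_measureReal, ← ENNReal.ofReal_add measureReal_nonneg (by positivity),
      ← ENNReal.ofReal_add (by positivity) (by positivity)]
    congr 1; ring
  rw [measureReal_def]
  exact ENNReal.toReal_le_of_le_ofReal (by positivity) htot

/-- Exponential bound on the failure probability, useful when the signal-to-noise ratio
`‖Δ‖ / σ` is large: a union bound over the threshold offset, the orthogonal component and the
component along `Δ`. -/
lemma compl_goodNoise_le_of_large {Δ : EuclideanSpace ℝ (Fin J)} {σ q : ℝ} (hΔ : Δ ≠ 0)
    (hσ : 0 < σ) (hq : 0 < q) (hq1 : q * Real.exp (‖Δ‖ ^ 2) ≤ ‖Δ‖ / 2)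
    (hq2 : 8 * (q * Real.exp (‖Δ‖ ^ 2)) * (σ * √J + ‖Δ‖) ≤ ‖Δ‖ ^ 2) :
    ((stdGaussian (EuclideanSpace ℝ (Fin J))).prod (stdGaussian _)).real (goodNoise Δ σ q)ᶜ ≤
      5 * Real.exp (-(‖Δ‖ / σ) ^ 2 / 16) := by
  have hd : 0 < ‖Δ‖ := norm_pos_iff.2 hΔ
  have he := norm_normalize hΔ
  set e := ‖Δ‖⁻¹ • Δ with hedef
  set γ := gaussianReal 0 1 with hγ
  set μ := (stdGaussian (EuclideanSpace ℝ (Fin J))).prod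
    (stdGaussian (EuclideanSpace ℝ (Fin J))) with hμ
  set a := ‖Δ‖ / σ with ha
  have ha0 : 0 < a := by positivity
  have hdir := map_inner_random_direction (u := fun x => unitDir e (Δ + σ • x))
    ((measurable_unitDir e).comp (by fun_prop)) fun x => norm_unitDir he _
  have hmy : Measurable fun p : EuclideanSpace ℝ (Fin J) × EuclideanSpace ℝ (Fin J) =>
      ⟪unitDir e (Δ + σ • p.1), p.2⟫ := by
    have := measurable_unitDir e
    fun_prop
  have hy : μ.map (fun p => ⟪unitDir e (Δ + σ • p.1), p.2⟫) = γ := by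
    have := congrArg (Measure.map Prod.snd) hdir
    rw [Measure.map_map measurable_snd (by have := measurable_unitDir e; fun_prop),
      Measure.map_snd_prod, measure_univ, one_smul] at this
    exact this
  have hg : μ.map (fun p => ⟪e, p.1⟫) = γ := by
    rw [hγ, ← map_inner_stdGaussian he]
    have h1 : μ.map Prod.fst = stdGaussian (EuclideanSpace ℝ (Fin J)) := by
      rw [hμ, Measure.map_fst_prod, measure_univ, one_smul]
    rw [← h1, Measure.map_map (by fun_prop) (by fun_prop)]
    rfl
  let A1 : Set (EuclideanSpace ℝ (Fin J) × EuclideanSpace ℝ (Fin J)) :=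
    {p | 2 * a ≤ |⟪unitDir e (Δ + σ • p.1), p.2⟫|}
  let A2 : Set (EuclideanSpace ℝ (Fin J) × EuclideanSpace ℝ (Fin J)) :=
    {p | 2 * (√J + a) ≤ ‖p.1‖}
  let A3 : Set (EuclideanSpace ℝ (Fin J) × EuclideanSpace ℝ (Fin J)) :=
    {p | a / 2 ≤ |⟪e, p.1⟫|}
  have hA1 : μ.real A1 ≤ 2 * Real.exp (-a ^ 2 / 16) := by
    have : μ.real A1 = γ.real {y | 2 * a ≤ |y|} := by
      rw [← hy, map_measureReal_apply hmy (measurableSet_le measurable_const (by fun_prop))]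
      rfl
    rw [this]
    refine (gaussianReal_abs_ge_le (by positivity)).trans ?_
    exact mul_le_mul_of_nonneg_left (Real.exp_le_exp.2 (by nlinarith)) zero_le_two
  have hA2 : μ.real A2 ≤ Real.exp (-a ^ 2 / 16) := by
    have : μ.real A2 = (stdGaussian (EuclideanSpace ℝ (Fin J))).real
        {x | 2 * (√J + a) ≤ ‖x‖} := by
      have h1 : μ.map Prod.fst = stdGaussian (EuclideanSpace ℝ (Fin J)) := by
        rw [hμ, Measure.map_fst_prod, measure_univ, one_smul]
      rw [← h1, map_measureReal_apply measurable_fst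
        (measurableSet_le measurable_const (by fun_prop))]
      rfl
    rw [this]
    refine (stdGaussian_norm_ge_le J ha0.le).trans ?_
    exact Real.exp_le_exp.2 (by nlinarith)
  have hA3 : μ.real A3 ≤ 2 * Real.exp (-a ^ 2 / 16) := by
    have : μ.real A3 = γ.real {y | a / 2 ≤ |y|} := by
      rw [← hg, map_measureReal_apply (by fun_prop) (measurableSet_le measurable_const
        (by fun_prop))]
      rfl
    rw [this]
    refine (gaussianReal_abs_ge_le (by positivity)).trans (le_of_eq ?_)
    congr 2; ring
  have hsub : (goodNoise Δ σ q)ᶜ ⊆ A1 ∪ A2 ∪ A3 := by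
    intro p hp
    by_contra hcon
    simp only [Set.mem_union, not_or, A1, A2, A3, Set.mem_ofPred_eq, not_le] at hcon
    obtain ⟨⟨h1, h2⟩, h3⟩ := hcon
    have hbad := compl_goodNoise_subset hΔ hσ hq hp
    simp only [Set.mem_preimage, Set.mem_union, Set.mem_ofPred_eq] at hbad
    set y := ⟪unitDir e (Δ + σ • p.1), p.2⟫
    have hv : q * Real.exp ((σ / 2 * y) ^ 2) ≤ q * Real.exp (‖Δ‖ ^ 2) := by
      have : (σ / 2 * y) ^ 2 ≤ ‖Δ‖ ^ 2 := by
        rw [← sq_abs]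
        refine pow_le_pow_left₀ (abs_nonneg _) ?_ 2
        rw [abs_mul, abs_of_pos (by positivity)]
        calc σ / 2 * |y| ≤ σ / 2 * (2 * a) := by gcongr
          _ = ‖Δ‖ := by rw [ha]; field_simp
      gcongr
    rcases hbad with h | h
    · linarith
    · have hW : ‖p.1 - ⟪e, p.1⟫ • e‖ ≤ 2 * (√J + a) := (norm_orthogonal_le he _).trans h2.le
      have hU : 2 * (q * Real.exp ((σ / 2 * y) ^ 2)) * ‖p.1 - ⟪e, p.1⟫ • e‖ / ‖Δ‖ ≤ a / 2 := by
        calc 2 * (q * Real.exp ((σ / 2 * y) ^ 2)) * ‖p.1 - ⟪e, p.1⟫ • e‖ / ‖Δ‖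
            ≤ 2 * (q * Real.exp (‖Δ‖ ^ 2)) * (2 * (√J + a)) / ‖Δ‖ := by gcongr
          _ = 8 * (q * Real.exp (‖Δ‖ ^ 2)) * (σ * √J + ‖Δ‖) / (2 * σ * ‖Δ‖) := by
              rw [ha]; field_simp; ring
          _ ≤ ‖Δ‖ ^ 2 / (2 * σ * ‖Δ‖) := by gcongr
          _ = a / 2 := by rw [ha]; field_simp
      have := neg_abs_le ⟪e, p.1⟫
      linarith
  calc μ.real (goodNoise Δ σ q)ᶜ ≤ μ.real (A1 ∪ A2 ∪ A3) := measureReal_mono hsub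
    _ ≤ μ.real A1 + μ.real A2 + μ.real A3 :=
        (measureReal_union_le _ _).trans (by gcongr; exact measureReal_union_le _ _)
    _ ≤ _ := by linarith

end Bounds

/-! ### Separation by the estimated half-space -/

/-- The constant `φ(0) exp (-C)`, where `φ` is the standard Gaussian density. It satisfies
`densityConst C * exp (-m²) ≤ φ(|m| + h / 2)` whenever `h² ≤ 4 C`. -/
noncomputable def densityConst (C : ℝ) : ℝ := (√(2 * Real.pi))⁻¹ * Real.exp (-C)

lemma densityConst_pos (C : ℝ) : 0 < densityConst C := by
  have := Real.pi_pos
  unfold densityConst; positivity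

lemma densityConst_mul_exp_le {C h m : ℝ} (hh : h ^ 2 ≤ 4 * C) :
    densityConst C * Real.exp (-m ^ 2) ≤ gaussianPDFReal 0 1 (|m| + h / 2) := by
  simp only [densityConst, gaussianPDFReal, sub_zero, NNReal.coe_one, mul_one]
  rw [mul_assoc, ← Real.exp_add]
  have : -C + -m ^ 2 ≤ -(|m| + h / 2) ^ 2 / 2 := by
    nlinarith [sq_nonneg (|m| - h / 2), sq_abs m]
  gcongr

lemma head_sub (J : ℕ) (θ θ' : ℕ → ℝ) : head J θ - head J θ' = head J (fun j => θ j - θ' j) := rfl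

lemma sepSet_eq {J n : ℕ} (w : (Fin n → ℕ → ℝ) × (Fin n → ℕ → ℝ)) :
    sepSet J w = {z | ⟪head J (empMean w.1) - head J (empMean w.2),
        (2 : ℝ)⁻¹ • (head J (empMean w.1) + head J (empMean w.2))⟫ ≤
      ⟪head J (empMean w.1) - head J (empMean w.2), head J z⟫} := by
  ext z
  simp only [sepSet, truncLR, Set.mem_ofPred_eq]
  rw [← sub_nonneg (b := inner ℝ _ (_ • _)), ← inner_sub_right, Finset.sum_range,
    mul_nonneg_iff_of_pos_left two_pos]
  refine iff_of_eq (congrArg _ ?_)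
  simp only [PiLp.inner_apply, head, PiLp.sub_apply, PiLp.smul_apply, PiLp.add_apply,
    smul_eq_mul, RCLike.inner_apply, conj_trivial]
  exact Finset.sum_congr rfl fun j _ => by ring

/-- On the event that the noise is good, the estimated half-space separates the two measures. -/
lemma le_separation_of_goodNoise {J n : ℕ} (hn : n ≠ 0) {θ θ' : ℕ → ℝ} {C q : ℝ}
    (hC : ‖head J θ - head J θ'‖ ^ 2 ≤ 4 * C) (hq : 0 ≤ q)
    {w : (Fin n → ℕ → ℝ) × (Fin n → ℕ → ℝ)}
    (hw : (diffNoise J θ θ' w, sumNoise J θ θ' w) ∈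
      goodNoise (head J θ - head J θ') (√((n : ℝ) / 2))⁻¹ q) :
    q * densityConst C ≤ separation (gaussSeq θ) (gaussSeq θ') (sepSet J w) := by
  have hs : 0 < √((n : ℝ) / 2) := Real.sqrt_pos.2 (by positivity)
  have hD : head J θ - head J θ' + (√((n : ℝ) / 2))⁻¹ • diffNoise J θ θ' w =
      head J (empMean w.1) - head J (empMean w.2) := by
    rw [diffNoise, smul_smul, inv_mul_cancel₀ hs.ne', one_smul]; abel
  have hM : head J (empMean w.1) + head J (empMean w.2) =
      head J θ + head J θ' + (√((n : ℝ) / 2))⁻¹ • sumNoise J θ θ' w := by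
    rw [sumNoise, smul_smul, inv_mul_cancel₀ hs.ne', one_smul]; abel
  obtain ⟨h0, h1⟩ := hw
  simp only [hD] at h0 h1
  rw [sepSet_eq, hM]
  set D := head J (empMean w.1) - head J (empMean w.2)
  set σ := (√((n : ℝ) / 2))⁻¹
  set ζ := sumNoise J θ θ' w
  have hn0 : 0 < ‖D‖ := norm_pos_iff.2 h0
  set m := σ / 2 * (⟪D, ζ⟫ / ‖D‖) with hm
  set h := ⟪D, head J θ - head J θ'⟫ / ‖D‖ with hh
  have hqh : q * Real.exp (m ^ 2) ≤ h := by rw [hh, le_div_iff₀ hn0]; exact h1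
  have hh0 : 0 ≤ h := le_trans (by positivity) hqh
  have hhle : h ≤ ‖head J θ - head J θ'‖ := by
    rw [hh, div_le_iff₀ hn0, mul_comm]; exact real_inner_le_norm _ _
  have hsep := le_separation_halfSpace θ θ' h0
    ⟪D, (2 : ℝ)⁻¹ • (head J θ + head J θ' + σ • ζ)⟫ (h := h) (m := -m)
    (by rw [hh, div_mul_cancel₀ _ hn0.ne', inner_sub_right])
    (by
      rw [hm, inner_smul_right, inner_add_right, inner_add_right, inner_smul_right]
      field_simp; ring) hh0
  refine le_trans ?_ hsep
  have hh2 : h ^ 2 ≤ 4 * C := (pow_le_pow_left₀ hh0 hhle 2).trans hC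
  calc q * densityConst C
      = (q * Real.exp (m ^ 2)) * (densityConst C * Real.exp (-m ^ 2)) := by
        rw [Real.exp_neg]; field_simp
    _ ≤ h * gaussianPDFReal 0 1 (|m| + h / 2) :=
        mul_le_mul hqh (densityConst_mul_exp_le hh2)
          (mul_nonneg (densityConst_pos C).le (Real.exp_pos _).le) hh0
    _ = _ := by rw [abs_neg]

/-- The total variation distance is at least of the order of the distance of the truncated means,
as long as the latter is bounded. -/
lemma norm_mul_densityConst_le_tvDist {J : ℕ} {θ θ' : ℕ → ℝ} {C : ℝ}
    (hC : ‖head J θ - head J θ'‖ ^ 2 ≤ 4 * C) :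
    ‖head J θ - head J θ'‖ * densityConst C ≤ tvDist (gaussSeq θ) (gaussSeq θ') := by
  rcases eq_or_ne (head J θ - head J θ') 0 with h0 | h0
  · rw [h0, norm_zero, zero_mul]
    exact Real.iSup_nonneg fun _ => abs_nonneg _
  have hsep := le_separation_halfSpace θ θ' h0
    ((⟪head J θ - head J θ', head J θ⟫ + ⟪head J θ - head J θ', head J θ'⟫) / 2)
    (h := ‖head J θ - head J θ'‖) (m := 0)
    (by rw [← inner_sub_right, real_inner_self_eq_norm_mul_norm]) (by ring) (norm_nonneg _)
  refine le_trans ?_ (hsep.trans (separation_le_tvDist _ _ (measurableSet_halfSpace _ _)))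
  have := densityConst_mul_exp_le (m := 0) hC
  rw [show -(0 : ℝ) ^ 2 = 0 by ring, Real.exp_zero, mul_one] at this
  gcongr

/-! ### Sobolev ellipsoids -/

section Sobolev

variable {s C : ℝ} {θ θ' : ℕ → ℝ}

lemma one_le_weight (hs : 0 < s) (j : ℕ) : 1 ≤ ((j : ℝ) + 1) ^ (2 * s) :=
  Real.one_le_rpow (by linarith [j.cast_nonneg (α := ℝ)]) (by positivity)

lemma sobolev_sub (hθ : θ ∈ sobolevEllipsoid s C) (hθ' : θ' ∈ sobolevEllipsoid s C) :
    Summable (fun j : ℕ => ((j : ℝ) + 1) ^ (2 * s) * (θ j - θ' j) ^ 2) ∧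
      ∑' j : ℕ, ((j : ℝ) + 1) ^ (2 * s) * (θ j - θ' j) ^ 2 ≤ 4 * C := by
  have hw : ∀ j : ℕ, 0 ≤ ((j : ℝ) + 1) ^ (2 * s) := fun j => by positivity
  have hsum := (hθ.1.mul_left 2).add (hθ'.1.mul_left 2)
  have hle : ∀ j : ℕ, ((j : ℝ) + 1) ^ (2 * s) * (θ j - θ' j) ^ 2 ≤
      2 * (((j : ℝ) + 1) ^ (2 * s) * θ j ^ 2) + 2 * (((j : ℝ) + 1) ^ (2 * s) * θ' j ^ 2) := by
    intro j
    nlinarith [mul_nonneg (hw j) (sq_nonneg (θ j + θ' j))]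
  have hs' := Summable.of_nonneg_of_le (fun j => mul_nonneg (hw j) (sq_nonneg _)) hle hsum
  refine ⟨hs', (hs'.tsum_le_tsum hle hsum).trans ?_⟩
  rw [(hθ.1.mul_left 2).tsum_add (hθ'.1.mul_left 2), tsum_mul_left, tsum_mul_left]
  linarith [hθ.2, hθ'.2]

lemma summable_sq_sub (hs : 0 < s) (hθ : θ ∈ sobolevEllipsoid s C)
    (hθ' : θ' ∈ sobolevEllipsoid s C) : Summable fun j => (θ j - θ' j) ^ 2 :=
  Summable.of_nonneg_of_le (fun _ => sq_nonneg _)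
    (fun j => le_mul_of_one_le_left (sq_nonneg _) (one_le_weight hs j)) (sobolev_sub hθ hθ').1

lemma norm_head_sq (J : ℕ) (z : ℕ → ℝ) : ‖head J z‖ ^ 2 = ∑ j ∈ Finset.range J, z j ^ 2 := by
  rw [EuclideanSpace.norm_sq_eq, Finset.sum_range]
  simp [head]

lemma norm_head_sub_sq_le (hs : 0 < s) (hθ : θ ∈ sobolevEllipsoid s C)
    (hθ' : θ' ∈ sobolevEllipsoid s C) (J : ℕ) : ‖head J θ - head J θ'‖ ^ 2 ≤ 4 * C := by
  rw [head_sub, norm_head_sq]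
  have h1 := (summable_sq_sub hs hθ hθ').sum_le_tsum (Finset.range J) fun j _ => sq_nonneg _
  have h2 := (summable_sq_sub hs hθ hθ').tsum_le_tsum
    (fun j => le_mul_of_one_le_left (sq_nonneg _) (one_le_weight hs j)) (sobolev_sub hθ hθ').1
  exact h1.trans (h2.trans (sobolev_sub hθ hθ').2)

/-- The truncation error of a difference of two elements of a Sobolev ellipsoid. -/
lemma tsum_sq_sub_le (hs : 0 < s) (hθ : θ ∈ sobolevEllipsoid s C)
    (hθ' : θ' ∈ sobolevEllipsoid s C) (J : ℕ) {ρ : ℝ}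
    (hJ : 4 * C ≤ ρ * ((J : ℝ) + 1) ^ (2 * s)) :
    ∑' j, (θ j - θ' j) ^ 2 ≤ ‖head J θ - head J θ'‖ ^ 2 + ρ := by
  have hS := summable_sq_sub hs hθ hθ'
  have hsob := sobolev_sub hθ hθ'
  rw [head_sub, norm_head_sq, ← hS.sum_add_tsum_nat_add J]
  gcongr
  have hW : 0 < ((J : ℝ) + 1) ^ (2 * s) := by positivity
  have htail : ∀ j : ℕ, ((J : ℝ) + 1) ^ (2 * s) * (θ (j + J) - θ' (j + J)) ^ 2 ≤
      (((j + J : ℕ) : ℝ) + 1) ^ (2 * s) * (θ (j + J) - θ' (j + J)) ^ 2 := by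
    intro j
    refine mul_le_mul_of_nonneg_right ?_ (sq_nonneg _)
    refine Real.rpow_le_rpow (by positivity) ?_ (by positivity)
    push_cast; linarith [j.cast_nonneg (α := ℝ)]
  have h1 := (((summable_nat_add_iff J).2 hS).mul_left (((J : ℝ) + 1) ^ (2 * s))).tsum_le_tsum
    htail ((summable_nat_add_iff J).2 hsob.1)
  have h2 := hsob.1.sum_add_tsum_nat_add J
  have h3 : 0 ≤ ∑ j ∈ Finset.range J, ((j : ℝ) + 1) ^ (2 * s) * (θ j - θ' j) ^ 2 :=
    Finset.sum_nonneg fun j _ => by positivity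
  rw [tsum_mul_left] at h1
  refine le_of_mul_le_mul_left ?_ hW
  rw [mul_comm _ ρ]
  linarith [hsob.2]

lemma segment_mem_sobolevEllipsoid (hθ : θ ∈ sobolevEllipsoid s C)
    (hθ' : θ' ∈ sobolevEllipsoid s C) {t : ℝ} (ht0 : 0 ≤ t) (ht1 : t ≤ 1) :
    (fun j => θ' j + t * (θ j - θ' j)) ∈ sobolevEllipsoid s C := by
  have hw : ∀ j : ℕ, 0 ≤ ((j : ℝ) + 1) ^ (2 * s) := fun j => by positivity
  have hsum := (hθ.1.mul_left t).add (hθ'.1.mul_left (1 - t))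
  have hle : ∀ j : ℕ, ((j : ℝ) + 1) ^ (2 * s) * (θ' j + t * (θ j - θ' j)) ^ 2 ≤
      t * (((j : ℝ) + 1) ^ (2 * s) * θ j ^ 2) +
        (1 - t) * (((j : ℝ) + 1) ^ (2 * s) * θ' j ^ 2) := by
    intro j
    have h : (θ' j + t * (θ j - θ' j)) ^ 2 ≤ t * θ j ^ 2 + (1 - t) * θ' j ^ 2 := by
      nlinarith [mul_nonneg (mul_nonneg ht0 (sub_nonneg.2 ht1)) (sq_nonneg (θ j - θ' j))]
    calc _ ≤ ((j : ℝ) + 1) ^ (2 * s) * (t * θ j ^ 2 + (1 - t) * θ' j ^ 2) :=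
          mul_le_mul_of_nonneg_left h (hw j)
      _ = _ := by ring
  have hs' := Summable.of_nonneg_of_le (fun j => mul_nonneg (hw j) (sq_nonneg _)) hle hsum
  refine ⟨hs', (hs'.tsum_le_tsum hle hsum).trans ?_⟩
  rw [(hθ.1.mul_left t).tsum_add (hθ'.1.mul_left (1 - t)), tsum_mul_left, tsum_mul_left]
  nlinarith [hθ.2, hθ'.2]

end Sobolev

/-! ### Lower bound on the testing sample complexity -/

lemma exists_test_of_nTS_le {𝒳 : Type*} [MeasurableSpace 𝒳] {ε δ c' : ℝ}
    {𝓜 : Set (ProbabilityMeasure 𝒳)} (hc' : 0 < c') {n : ℕ}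
    (h : ENNReal.ofReal (1 / c') * (nTS ε δ 𝓜 : ℝ≥0∞) ≤ (n : ℝ≥0∞)) :
    ∃ N : ℕ, (N : ℝ) ≤ c' * n ∧ ∃ ψ, IsTwoSampleTest ε δ 𝓜 N ψ := by
  have hpos : ENNReal.ofReal (1 / c') ≠ 0 := by
    simpa using hc'
  have hne : nTS ε δ 𝓜 ≠ ⊤ := by
    intro ht
    rw [ht, ENat.toENNReal_top, ENNReal.mul_top hpos] at h
    exact absurd h (by simp)
  have hmem : nTS ε δ 𝓜 ∈ {N : ℕ∞ | ∃ N₀ : ℕ, N = (N₀ : ℕ∞) ∧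
      ∀ n : ℕ, N₀ ≤ n → ∃ ψ, IsTwoSampleTest ε δ 𝓜 n ψ} := by
    refine csInf_mem (Set.nonempty_iff_ne_empty.2 fun he => hne ?_)
    rw [nTS, he, sInf_empty]
  obtain ⟨N, hN, htest⟩ := hmem
  refine ⟨N, ?_, htest N le_rfl⟩
  rw [hN, ENat.toENNReal_coe, ← ENNReal.ofReal_natCast N, ← ENNReal.ofReal_natCast n,
    ← ENNReal.ofReal_mul (by positivity), ENNReal.ofReal_le_ofReal_iff n.cast_nonneg,
    one_div_mul_eq_div, div_le_iff₀ hc'] at h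
  linarith

/-- A two-sample test must in particular tell `θ'` from a point of the segment `[θ', θ]` whose
total variation distance to `θ'` is of the order of `ε`. -/
lemma exp_le_of_isTwoSampleTest {s C ε δ : ℝ} (hs : 0 < s) (hε : 0 < ε) (hδ : 0 < δ)
    (hδ2 : δ < 1 / 2) {θ θ' : ℕ → ℝ} (hθ : θ ∈ sobolevEllipsoid s C)
    (hθ' : θ' ∈ sobolevEllipsoid s C) (htv : ε ≤ tvDist (gaussSeq θ) (gaussSeq θ')) {J : ℕ}
    (hJ : ∑' j, (θ j - θ' j) ^ 2 ≤ 4 / 3 * ‖head J θ - head J θ'‖ ^ 2)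
    {N : ℕ} {ψ} (hψ : IsTwoSampleTest ε δ (gaussClass s C) N ψ) :
    Real.exp (-(N * ε ^ 2) / (2 * densityConst C ^ 2)) ≤ 4 * δ * (1 - δ) := by
  have hk := densityConst_pos C
  set k := densityConst C
  set d := ‖head J θ - head J θ'‖ with hd
  have hd4 : d ^ 2 ≤ 4 * C := norm_head_sub_sq_le hs hθ hθ' J
  obtain ⟨t, ht0, ht1, htd, httv⟩ : ∃ t : ℝ, 0 ≤ t ∧ t ≤ 1 ∧ t * d ≤ ε / k ∧
      ε ≤ tvDist (gaussSeq fun j => θ' j + t * (θ j - θ' j)) (gaussSeq θ') := by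
    rcases le_or_gt d (ε / k) with h | h
    · refine ⟨1, zero_le_one, le_rfl, by linarith, ?_⟩
      simpa using htv
    · have hek : 0 < ε / k := by positivity
      have hd0 : 0 < d := hek.trans h
      have htd : ε / k / d * d = ε / k := div_mul_cancel₀ _ hd0.ne'
      have ht1 : ε / k / d ≤ 1 := (div_le_one hd0).2 h.le
      refine ⟨ε / k / d, by positivity, ht1, htd.le, ?_⟩
      have hnorm : ‖head J (fun j => θ' j + ε / k / d * (θ j - θ' j)) - head J θ'‖ = ε / k := by
        have : head J (fun j => θ' j + ε / k / d * (θ j - θ' j)) - head J θ' =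
            (ε / k / d) • (head J θ - head J θ') := by
          ext j; simp [head]
        rw [this, norm_smul, ← hd, Real.norm_eq_abs, abs_of_pos (by positivity), htd]
      have := norm_mul_densityConst_le_tvDist (J := J) (C := C)
        (θ := fun j => θ' j + ε / k / d * (θ j - θ' j)) (θ' := θ')
        (by rw [hnorm]; exact (pow_le_pow_left₀ hek.le h.le 2).trans hd4)
      rw [hnorm] at this
      rwa [show ε / k * densityConst C = ε from div_mul_cancel₀ _ hk.ne'] at this
  have hmem := segment_mem_sobolevEllipsoid hθ hθ' ht0 ht1
  have hS := summable_sq_sub hs hmem hθ'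
  have haff := hasAffinity_twoSampleLaw (n := N) hS
  have hA : MeasurableSet {w | ψ w = true} := hψ.1 (measurableSet_singleton true)
  have hA' : {w | ψ w = true}ᶜ = {w | ψ w = false} := by
    ext w; simp
  have h1 := hψ.2.1 _ ⟨_, hmem, rfl⟩
  have h2 := hψ.2.2 _ ⟨_, hmem, rfl⟩ _ ⟨_, hθ', rfl⟩ httv
  have : IsProbabilityMeasure (twoSampleLaw N (gaussSeq fun j => θ' j + t * (θ j - θ' j))
      (gaussSeq fun j => θ' j + t * (θ j - θ' j))) := by
    unfold twoSampleLaw; infer_instance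
  have : IsProbabilityMeasure (twoSampleLaw N (gaussSeq fun j => θ' j + t * (θ j - θ' j))
      (gaussSeq θ')) := by
    unfold twoSampleLaw; infer_instance
  refine le_trans (Real.exp_le_exp.2 ?_)
    (haff.le_of_test hA hδ hδ2.le (by rw [hA']; linarith))
  have e : ∑' j, (θ' j + t * (θ j - θ' j) - θ' j) ^ 2 = t ^ 2 * ∑' j, (θ j - θ' j) ^ 2 := by
    rw [← tsum_mul_left]
    exact tsum_congr fun j => by ring
  have hle : t ^ 2 * ∑' j, (θ j - θ' j) ^ 2 ≤ 2 * (ε / k) ^ 2 := by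
    have h3 : (t * d) ^ 2 ≤ (ε / k) ^ 2 := pow_le_pow_left₀ (by positivity) htd 2
    calc t ^ 2 * ∑' j, (θ j - θ' j) ^ 2 ≤ t ^ 2 * (4 / 3 * d ^ 2) := by gcongr
      _ = 4 / 3 * (t * d) ^ 2 := by ring
      _ ≤ 2 * (ε / k) ^ 2 := by nlinarith [sq_nonneg (ε / k)]
  rw [e]
  have h4 : (N : ℝ) * (t ^ 2 * ∑' j, (θ j - θ' j) ^ 2) ≤ N * (2 * (ε / k) ^ 2) := by gcongr
  have h5 : -(N * ε ^ 2) / (2 * k ^ 2) = -(N * (2 * (ε / k) ^ 2)) / 4 := by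
    field_simp; norm_num
  rw [h5]
  linarith

/-! ### The truncation level and the separation rate -/

/-- The truncation level `(4C)^(1/(2s)) ε^(-1/s)` makes the squared truncation error at most
`ε ^ 2`. -/
lemma truncation_weight {s C ε K : ℝ} (hs : 0 < s) (hC : 0 < C) (hε : 0 < ε)
    (hK : (4 * C) ^ (1 / (2 * s)) * ε ^ (-(1 / s)) ≤ K) : 4 * C ≤ ε ^ 2 * K ^ (2 * s) := by
  have h1 : ((4 * C) ^ (1 / (2 * s)) * ε ^ (-(1 / s))) ^ (2 * s) = 4 * C * (ε ^ 2)⁻¹ := by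
    rw [Real.mul_rpow (by positivity) (by positivity), ← Real.rpow_mul (by positivity),
      ← Real.rpow_mul hε.le, one_div_mul_cancel (by positivity), Real.rpow_one,
      show -(1 / s) * (2 * s) = -2 by field_simp, Real.rpow_neg hε.le, Real.rpow_two]
  have h2 := Real.rpow_le_rpow (by positivity) hK (show 0 ≤ 2 * s by positivity)
  rw [h1] at h2
  calc 4 * C = ε ^ 2 * (4 * C * (ε ^ 2)⁻¹) := by field_simp
    _ ≤ _ := by gcongr

section Rate

/-! The target separation `c' (√(n ε^(1/s)) ∧ 1/ε) ε²` is compared with the truncated distance `d`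
of the means and with `r = √(n / 2)`, the inverse noise level of the difference of the empirical
means. The two entries of the minimum serve different purposes: the second one keeps the target
below `c' d`, the first one compensates the norm `√J` of the orthogonal noise. -/

variable {s ε c' d : ℝ} {n : ℕ}

lemma rate_le_inv (hc' : 0 ≤ c') (hε : 0 < ε) (hεd : ε ≤ d) :
    c' * min (√((n : ℝ) * ε ^ (1 / s))) (1 / ε) * ε ^ 2 ≤ c' * d :=
  calc c' * min (√((n : ℝ) * ε ^ (1 / s))) (1 / ε) * ε ^ 2
      ≤ c' * (1 / ε) * ε ^ 2 := by gcongr; exact min_le_right _ _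
    _ = c' * ε := by field_simp
    _ ≤ c' * d := by gcongr

variable {r : ℝ}

lemma sqrt_le_two_mul (hr2 : r ^ 2 = n / 2) (hr : 0 ≤ r) : √(n : ℝ) ≤ 2 * r := by
  rw [Real.sqrt_le_left (by positivity), mul_pow, hr2]
  linarith [n.cast_nonneg (α := ℝ)]

lemma rate_le_sqrt (hs : 0 < s) (hc' : 0 ≤ c') (hε : 0 < ε) (hε1 : ε ≤ 1)
    (hεd : ε ^ 2 ≤ d ^ 2) (hr2 : r ^ 2 = n / 2) (hr : 0 ≤ r) :
    c' * min (√((n : ℝ) * ε ^ (1 / s))) (1 / ε) * ε ^ 2 ≤ c' * (2 * r) * d ^ 2 :=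
  calc c' * min (√((n : ℝ) * ε ^ (1 / s))) (1 / ε) * ε ^ 2
      ≤ c' * √((n : ℝ) * ε ^ (1 / s)) * ε ^ 2 := by gcongr; exact min_le_left _ _
    _ ≤ c' * √((n : ℝ) * 1) * d ^ 2 := by
        gcongr
        exact Real.rpow_le_one hε.le hε1 (by positivity)
    _ ≤ c' * (2 * r) * d ^ 2 := by
        rw [mul_one]
        gcongr
        exact sqrt_le_two_mul hr2 hr

lemma rate_mul_sqrt_le {c j : ℝ} (hc' : 0 ≤ c') (hε : 0 < ε)
    (hεd : ε ^ 2 ≤ d ^ 2) (hr2 : r ^ 2 = n / 2) (hr : 0 ≤ r) (hj : j ≤ c * ε ^ (-(1 / s))) :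
    c' * min (√((n : ℝ) * ε ^ (1 / s))) (1 / ε) * ε ^ 2 * √j ≤ c' * (2 * r) * √c * d ^ 2 :=
  calc c' * min (√((n : ℝ) * ε ^ (1 / s))) (1 / ε) * ε ^ 2 * √j
      ≤ c' * √((n : ℝ) * ε ^ (1 / s)) * ε ^ 2 * √(c * ε ^ (-(1 / s))) := by
        gcongr; exact min_le_left _ _
    _ = c' * (√((n : ℝ) * ε ^ (1 / s)) * √(c * ε ^ (-(1 / s)))) * ε ^ 2 := by ring
    _ = c' * (√(n : ℝ) * √c) * ε ^ 2 := by
        rw [← Real.sqrt_mul (by positivity), ← Real.sqrt_mul (by positivity)]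
        congr 3
        rw [Real.rpow_neg hε.le]
        have : ε ^ (1 / s) ≠ 0 := by positivity
        field_simp
    _ ≤ c' * (2 * r * √c) * d ^ 2 := by
        gcongr
        exact sqrt_le_two_mul hr2 hr
    _ = _ := by ring

end Rate

section Failure

variable {J : ℕ} {Δ : EuclideanSpace ℝ (Fin J)} {r u k c c' : ℝ}

/-- The failure probability at the target separation `u`, for a bounded signal-to-noise ratio
`‖Δ‖ r`: the loss over the sign test is a small multiple of that ratio. -/
lemma failure_le_of_small {p : ℝ} (hΔ : Δ ≠ 0) (hr1 : 1 ≤ r) (hu : 0 < u)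
    (hk : 0 < k) (hc2 : c' ≤ p * k / (16 * (1 + √c)))
    (hun : u ≤ c' * (2 * r) * ‖Δ‖ ^ 2) (huJ : u * √(J : ℝ) ≤ c' * (2 * r) * √c * ‖Δ‖ ^ 2) :
    ((stdGaussian (EuclideanSpace ℝ (Fin J))).prod (stdGaussian _)).real
        (goodNoise Δ r⁻¹ (u / k))ᶜ ≤
      (gaussianReal 0 1).real (Set.Iio (-(‖Δ‖ * r))) + p / 2 * (‖Δ‖ * r) := by
  have hr0 : 0 < r := by linarith
  have hd0 : 0 < ‖Δ‖ := norm_pos_iff.2 hΔ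
  have h := compl_goodNoise_le_of_small hΔ (inv_pos.2 hr0) (inv_le_one_of_one_le₀ hr1)
    (div_pos hu hk)
  rw [div_inv_eq_mul, add_assoc] at h
  refine h.trans (add_le_add le_rfl ?_)
  calc 4 * (u / k) / ‖Δ‖ + 4 * (u / k) * √J / ‖Δ‖ = 4 * (u + u * √J) / (k * ‖Δ‖) := by
        field_simp
    _ ≤ 4 * (c' * (2 * r) * ‖Δ‖ ^ 2 + c' * (2 * r) * √c * ‖Δ‖ ^ 2) / (k * ‖Δ‖) := by gcongr
    _ = c' * (8 * (1 + √c) / k * (‖Δ‖ * r)) := by field_simp; ring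
    _ ≤ p * k / (16 * (1 + √c)) * (8 * (1 + √c) / k * (‖Δ‖ * r)) := by gcongr
    _ = p / 2 * (‖Δ‖ * r) := by field_simp; ring

/-- The failure probability at the target separation `u`, for a large signal-to-noise ratio. -/
lemma failure_le_of_large {C : ℝ} (hΔ : Δ ≠ 0) (hr0 : 0 < r) (hu : 0 < u) (hk : 0 < k)
    (hc'0 : 0 < c') (hd4 : ‖Δ‖ ^ 2 ≤ 4 * C)
    (hc5 : c' ≤ k * Real.exp (-(4 * C)) / (8 * (2 * √c + 1)))
    (huε : u ≤ c' * ‖Δ‖) (huJ : u * √(J : ℝ) ≤ c' * (2 * r) * √c * ‖Δ‖ ^ 2) :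
    ((stdGaussian (EuclideanSpace ℝ (Fin J))).prod (stdGaussian _)).real
        (goodNoise Δ r⁻¹ (u / k))ᶜ ≤ 5 * Real.exp (-(‖Δ‖ * r) ^ 2 / 16) := by
  have hE : Real.exp (‖Δ‖ ^ 2) ≤ Real.exp (4 * C) := Real.exp_le_exp.2 hd4
  have hc5' : 8 * (c' / k * Real.exp (4 * C)) * (2 * √c + 1) ≤ 1 := by
    rw [le_div_iff₀ (by positivity), Real.exp_neg] at hc5
    have : c' * (8 * (2 * √c + 1)) * (Real.exp (4 * C) / k) ≤
        k * (Real.exp (4 * C))⁻¹ * (Real.exp (4 * C) / k) := by gcongr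
    calc _ = c' * (8 * (2 * √c + 1)) * (Real.exp (4 * C) / k) := by ring
      _ ≤ _ := this
      _ = 1 := by field_simp
  have hb0 : 0 ≤ c' / k * Real.exp (4 * C) := by positivity
  have h := compl_goodNoise_le_of_large hΔ (inv_pos.2 hr0) (div_pos hu hk) ?_ ?_
  · rwa [div_inv_eq_mul] at h
  · calc u / k * Real.exp (‖Δ‖ ^ 2) ≤ c' * ‖Δ‖ / k * Real.exp (4 * C) := by gcongr
      _ = (c' / k * Real.exp (4 * C)) * ‖Δ‖ := by ring
      _ ≤ (1 / 2) * ‖Δ‖ := by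
          gcongr
          nlinarith [mul_nonneg hb0 (Real.sqrt_nonneg c)]
      _ = ‖Δ‖ / 2 := by ring
  · calc 8 * (u / k * Real.exp (‖Δ‖ ^ 2)) * (r⁻¹ * √J + ‖Δ‖)
        = 8 * (Real.exp (‖Δ‖ ^ 2) / k) * (r⁻¹ * (u * √J) + u * ‖Δ‖) := by ring
      _ ≤ 8 * (Real.exp (4 * C) / k) *
          (r⁻¹ * (c' * (2 * r) * √c * ‖Δ‖ ^ 2) + c' * ‖Δ‖ * ‖Δ‖) := by gcongr
      _ = 8 * (c' / k * Real.exp (4 * C)) * (2 * √c + 1) * ‖Δ‖ ^ 2 := by field_simp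
      _ ≤ 1 * ‖Δ‖ ^ 2 := by gcongr
      _ = ‖Δ‖ ^ 2 := one_mul _

end Failure

/-! ### Comparing the failure probability with the error level -/

/-- The error level `δ` of a test dominates the failure probability of the separating set. Here `a`
is the signal-to-noise ratio and `F` the failure probability; the level is bounded below by
`hδ`, the failure probability above by `h1` for bounded `a` and by `h2` in general. -/
lemma failure_le_level {a F δ κ p : ℝ} (ha : 0 ≤ a)
    (hp : p = gaussianPDFReal 0 1 32) (hκp : κ ≤ p ^ 2) (hκ : κ ≤ 1 / 32) (hδ0 : 0 < δ)
    (hδ : Real.exp (-(κ * a ^ 2)) ≤ 4 * δ * (1 - δ))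
    (h1 : F ≤ (gaussianReal 0 1).real (Set.Iio (-a)) + p / 2 * a)
    (h2 : F ≤ 5 * Real.exp (-a ^ 2 / 16)) : F ≤ δ := by
  have hp0 : 0 < p := hp ▸ gaussianPDFReal_pos _ _ _ one_ne_zero
  -- The threshold `32` makes `exp (a ^ 2 / 32)` at least `20`, which absorbs the constants `5`
  -- and `1 / 4` of the bounds for large `a`.
  rcases le_or_gt a 32 with h | h
  · have hΦ := gaussianReal_real_Iio_neg_le ha h
    rw [← hp] at hΦ
    have hexp := Real.add_one_le_exp (-(κ * a ^ 2))
    have hsq : (1 - 2 * δ) ^ 2 ≤ (p * a) ^ 2 := by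
      nlinarith [mul_le_mul_of_nonneg_right hκp (sq_nonneg a)]
    have := abs_le_of_sq_le_sq hsq (by positivity)
    linarith [(le_abs_self (1 - 2 * δ)).trans this]
  · have e1 : Real.exp (-a ^ 2 / 16) * Real.exp (a ^ 2 / 32) = Real.exp (-a ^ 2 / 32) := by
      rw [← Real.exp_add]; congr 1; ring
    have e2 : Real.exp (-a ^ 2 / 32) ≤ 4 * δ := by
      refine (Real.exp_le_exp.2 ?_).trans (hδ.trans (by nlinarith))
      nlinarith [sq_nonneg a]
    have e3 : 20 ≤ Real.exp (a ^ 2 / 32) := by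
      refine le_trans ?_ (Real.add_one_le_exp _)
      nlinarith
    have e4 : 20 * Real.exp (-a ^ 2 / 16) ≤ 4 * δ := by
      rw [← e1] at e2
      nlinarith [Real.exp_pos (-a ^ 2 / 16)]
    linarith

theorem mainTheorem4 (s C : ℝ) (hs : 0 < s) (hC : 0 < C) :
    ∃ c c' : ℝ, 0 < c ∧ 0 < c' ∧
      ∀ (ε δ : ℝ), 0 < ε → 0 < δ → δ < 1 / 2 →
      ∀ θX ∈ sobolevEllipsoid s C, ∀ θY ∈ sobolevEllipsoid s C,
        ε ≤ tvDist (gaussSeq θX) (gaussSeq θY) →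
      ∀ n : ℕ,
        ENNReal.ofReal (1 / c') * (nTS ε δ (gaussClass s C) : ℝ≥0∞) ≤ (n : ℝ≥0∞) →
        1 - δ ≤ (twoSampleLaw n (gaussSeq θX) (gaussSeq θY)).real
          {w | c' * min (Real.sqrt ((n : ℝ) * ε ^ (1 / s))) (1 / ε) * ε ^ 2 ≤
            separation (gaussSeq θX) (gaussSeq θY) (sepSet ⌊c * ε ^ (-(1 / s))⌋₊ w)} := by
  have hk := densityConst_pos C
  set k := densityConst C with hkdef
  obtain ⟨p, hp⟩ : ∃ p, p = gaussianPDFReal 0 1 32 := ⟨_, rfl⟩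
  have hp0 : 0 < p := hp ▸ gaussianPDFReal_pos _ _ _ one_ne_zero
  -- With this choice the coordinates beyond `J` carry at most `ε ^ 2` of the squared distance.
  set c : ℝ := (4 * C) ^ (1 / (2 * s)) with hc
  have hc0 : 0 < c := by positivity
  -- The bounds on `c'` serve, in this order: `2 ≤ n`; the linear loss in the failure probability;
  -- the level `δ` close to `1 / 2`; the level `δ` close to `0`; the union bound.
  obtain ⟨c', hc'0, hc1, hc2, hc3, hc4, hc5⟩ : ∃ c' : ℝ, 0 < c' ∧ c' ≤ 1 / 2 ∧
      c' ≤ p * k / (16 * (1 + √c)) ∧ c' ≤ p ^ 2 * k ^ 2 ∧ c' ≤ k ^ 2 / 32 ∧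
      c' ≤ k * Real.exp (-(4 * C)) / (8 * (2 * √c + 1)) :=
    ⟨min (1 / 2) (min (p * k / (16 * (1 + √c))) (min (p ^ 2 * k ^ 2) (min (k ^ 2 / 32)
      (k * Real.exp (-(4 * C)) / (8 * (2 * √c + 1)))))), by positivity, by simp, by simp, by simp,
      by simp, by simp⟩
  refine ⟨c, c', hc0, hc'0, ?_⟩
  intro ε δ hε hδ hδ2 θX hX θY hY htv n hn
  obtain ⟨N, hN, ψ, hψ⟩ := exists_test_of_nTS_le hc'0 hn
  have hS := summable_sq_sub hs hX hY
  have hε1 : ε ≤ 1 := by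
    have h1 := (hasAffinity_gaussSeq hS).le_one_sub_sq_tvDist
    have h2 := Real.exp_pos (-(∑' j, (θX j - θY j) ^ 2) / 4)
    have h3 : ε ^ 2 ≤ tvDist (gaussSeq θX) (gaussSeq θY) ^ 2 := pow_le_pow_left₀ hε.le htv 2
    nlinarith
  set J := ⌊c * ε ^ (-(1 / s))⌋₊ with hJdef
  have hJle : (J : ℝ) ≤ c * ε ^ (-(1 / s)) := Nat.floor_le (by positivity)
  have hJlt : c * ε ^ (-(1 / s)) ≤ (J : ℝ) + 1 := (Nat.lt_floor_add_one _).le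
  have hweight : 4 * C ≤ ε ^ 2 * ((J : ℝ) + 1) ^ (2 * s) := truncation_weight hs hC hε hJlt
  set d := ‖head J θX - head J θY‖ with hd
  have hdist := tsum_sq_sub_le hs hX hY J hweight
  have hfar := four_mul_sq_le_of_le_tvDist hS hε.le htv
  -- `4 ε ^ 2 ≤ d ^ 2 + ε ^ 2`, so truncation keeps three quarters of the squared
  -- distance.
  have hdε : ε ^ 2 ≤ d ^ 2 := by nlinarith [sq_nonneg ε]
  have hd0 : 0 < d := by
    refine (norm_nonneg _).lt_of_ne fun h => ?_
    rw [← hd] at h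
    rw [← h] at hdε
    nlinarith [pow_pos hε 2]
  have hεd : ε ≤ d := le_of_sq_le_sq hdε hd0.le
  have hd4 : d ^ 2 ≤ 4 * C := norm_head_sub_sq_le hs hX hY J
  have hlevel := exp_le_of_isTwoSampleTest hs hε hδ hδ2 hX hY htv (J := J) (by nlinarith) hψ
  rw [← hkdef] at hlevel
  -- No test exists without observations, so that `1 ≤ N ≤ c' n`.
  have hn2 : (2 : ℝ) ≤ n := by
    have hN0 : N ≠ 0 := by
      rintro rfl
      simp only [Nat.cast_zero, zero_mul, neg_zero, zero_div, Real.exp_zero] at hlevel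
      nlinarith [mul_pos (sub_pos.2 hδ2) (sub_pos.2 hδ2)]
    have hN1 : (1 : ℝ) ≤ N := by exact_mod_cast Nat.one_le_iff_ne_zero.2 hN0
    nlinarith
  have hn0 : n ≠ 0 := by
    rintro rfl
    norm_num at hn2
  set r := √((n : ℝ) / 2) with hr
  have hr2 : r ^ 2 = n / 2 := Real.sq_sqrt (by positivity)
  have hr0 : 0 < r := Real.sqrt_pos.2 (by positivity)
  have hr1 : 1 ≤ r := Real.one_le_sqrt.2 (by linarith)
  set u := c' * min (√((n : ℝ) * ε ^ (1 / s))) (1 / ε) * ε ^ 2 with hu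
  have hu0 : 0 < u := by
    have : 0 < (n : ℝ) := by linarith
    positivity
  have huε := rate_le_inv (n := n) (s := s) hc'0.le hε hεd
  have hun := rate_le_sqrt hs hc'0.le hε hε1 hdε hr2 hr0.le
  have huJ := rate_mul_sqrt_le (s := s) hc'0.le hε hdε hr2 hr0.le hJle
  rw [← hu] at huε hun huJ
  have hΔ : head J θX - head J θY ≠ 0 := norm_pos_iff.1 hd0
  have hq0 : 0 < u / k := by positivity
  set F := ((stdGaussian (EuclideanSpace ℝ (Fin J))).prod (stdGaussian _)).real
    (goodNoise (head J θX - head J θY) r⁻¹ (u / k))ᶜ with hF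
  have hsmall : F ≤ (gaussianReal 0 1).real (Set.Iio (-(d * r))) + p / 2 * (d * r) :=
    failure_le_of_small hΔ hr1 hu0 hk hc2 hun huJ
  have hlarge : F ≤ 5 * Real.exp (-(d * r) ^ 2 / 16) :=
    failure_le_of_large hΔ hr0 hu0 hk hc'0 hd4 hc5 huε huJ
  have hFδ : F ≤ δ := by
    refine failure_le_level (κ := c' / k ^ 2) (by positivity) hp ?_ ?_ hδ ?_ hsmall hlarge
    · rw [div_le_iff₀ (by positivity)]; exact hc3
    · rw [div_le_iff₀ (by positivity)]; linarith
    · refine le_trans (Real.exp_le_exp.2 ?_) hlevel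
      rw [neg_div, neg_le_neg_iff, mul_pow, hr2]
      calc N * ε ^ 2 / (2 * k ^ 2) ≤ c' * n * d ^ 2 / (2 * k ^ 2) := by gcongr
        _ = c' / k ^ 2 * (d ^ 2 * (n / 2)) := by field_simp
  have hgm := measurableSet_goodNoise (head J θX - head J θY) r⁻¹ (u / k)
  have hgood : ((stdGaussian (EuclideanSpace ℝ (Fin J))).prod (stdGaussian _)).real
      (goodNoise (head J θX - head J θY) r⁻¹ (u / k)) = 1 - F := by
    rw [hF, probReal_compl_eq_one_sub hgm]; ring
  have : IsProbabilityMeasure (twoSampleLaw n (gaussSeq θX) (gaussSeq θY)) := by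
    unfold twoSampleLaw; infer_instance
  calc 1 - δ ≤ 1 - F := by linarith
    _ = (twoSampleLaw n (gaussSeq θX) (gaussSeq θY)).real
        ((fun w => (diffNoise J θX θY w, sumNoise J θX θY w)) ⁻¹'
          goodNoise (head J θX - head J θY) r⁻¹ (u / k)) := by
        rw [← hgood, ← map_noise_twoSampleLaw hn0 J θX θY,
          map_measureReal_apply (measurable_noise J θX θY) hgm]
    _ ≤ _ := by
        refine measureReal_mono fun w hw => ?_
        have h := le_separation_of_goodNoise hn0 hd4 hq0.le hw
        rwa [← hkdef, div_mul_cancel₀ _ hk.ne'] at h
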